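/- For a partition $\mu=(\mu_1\ge\mu_2\ge\cdots)$ with $l(\mu)$ nonzero parts put $|\mu|=\sum_i\mu_i$ and $\kappa_\mu=\sum_{i\ge1}\mu_i(\mu_i-2i+1)$. Let $h_k$ be the complete homogeneous symmetric functions ($h_k=0$ for $k<0$) and $s_\mu=\det(h_{\mu_i-i+j})_{1\le i,j\le l(\mu)}$ the Schur functions in infinitely many variables. The Hopf link invariants are $$W_{\mu,\nu}(q)=s_\mu(q^{\varrho})\,s_\nu(q^{\mu+\varrho}),\qquad q^{\varrho}=(q^{-1/2},q^{-3/2},q^{-5/2},\dots),\quad q^{\mu+\varrho}=(q^{\mu_1-1/2},q^{\mu_2-3/2},q^{\mu_3-5/2},\dots),$$ expanded as formal Laurent series in $q^{-1/2}$ with coefficients in $\mathbb C$ (finitely many positive powers of $q$). Define the power series in $t$ $$Z=\sum_{\mu^1,\mu^2,\mu^3}W_{\mu^1,\mu^2}(q)\,W_{\mu^2,\mu^3}(q)\,W_{\mu^3,\mu^1}(q)\;q^{\frac12\sum_{i=1}^3\kappa_{\mu^i}}\,(-t)^{\sum_{i=1}^3|\mu^i|},$$ the sum being over all triples of partitions,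 and let $I(d)$ be the coefficient of $t^d$ in $Z$. Put $[\infty]_{q^{-1}}!=\prod_{i\ge1}(1-q^{-i})$. \textbf{Theorem.} For every integer $d\ge1$, the series $$(-1)^d\,q^{-(d^2-3d)/2}\,I(d)$$ and $$\frac1{([\infty]_{q^{-1}}!)^3}\biggl[\binom{d+2}2-3\sum_{i\ge1}\frac{q^{-i}}{(1-q^{-i})^2}+\frac{3\,q^{-d-2}}{(1-q^{-1})^2}\biggl(\binom{d+1}2-3\sum_{i\ge1}\frac{q^{-i}}{(1-q^{-i})^2}+3\biggr)\biggr]$$ have the same coefficient at every power $q^r$ (with $r$ an integer or half-integer) such that $r>-2d$. -/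

import Mathlib

namespace LocalP2

/-- Formal series with coefficients in `ℂ` and finitely many positive powers of `q`, in half-integer
powers of `q`: the variable of the Laurent series field is `u = q ^ (-1/2)`. Thus expansions are at
`q = ∞`, and `ℂ[q, q⁻¹]]` is the subring of series in `u ^ 2 = q⁻¹`. Infinite sums and products are
taken in the `u`-adic (that is, `q ^ (-1/2)`-adic) topology, which Mathlib puts on this field. -/
abbrev QSeries : Type := LaurentSeries ℂ

/-- `q ^ (n / 2)`. -/
noncomputable def qHalfPow (n : ℤ) : QSeries := HahnSeries.single (-n) 1

/-- `q ^ n`. -/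
noncomputable def qPow (n : ℤ) : QSeries := qHalfPow (2 * n)

/-- The coefficient of `q ^ (n / 2)` in `f`. -/
noncomputable def qHalfCoeff (n : ℤ) (f : QSeries) : ℂ := f.coeff (-n)

/-- `f = g |_{q^{> N}}`: the series `f` and `g` have the same coefficients at all (integer and
half-integer) powers `q ^ r` with `r > N`. -/
def EqAbove (N : ℤ) (f g : QSeries) : Prop :=
  ∀ n : ℤ, 2 * N < n → qHalfCoeff n f = qHalfCoeff n g

/-- The complete homogeneous symmetric function `h_k(x_0, x_1, …)`: the sum of all monomials of
degree `k`, indexed by the multisets of size `k` of indices. -/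
noncomputable def hsymm (x : ℕ → QSeries) (k : ℕ) : QSeries :=
  ∑' a : Sym ℕ k, ((a : Multiset ℕ).map x).prod

/-- `h_k` for an integer index, with `h_k = 0` for `k < 0`. -/
noncomputable def hsymmInt (x : ℕ → QSeries) (k : ℤ) : QSeries :=
  if 0 ≤ k then hsymm x k.toNat else 0

/-- The Schur function `s_μ(x_0, x_1, …) = det (h_{μ_i - i + j})_{1 ≤ i, j ≤ l(μ)}`, where
`μ.colLen 0 = l(μ)` is the number of rows and `μ.rowLen i` is the part `μ_{i+1}`. -/
noncomputable def schur (μ : YoungDiagram) (x : ℕ → QSeries) : QSeries :=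
  (Matrix.of fun i j : Fin (μ.colLen 0) =>
    hsymmInt x ((μ.rowLen i : ℤ) - (i : ℤ) + (j : ℤ))).det

/-- `q^ϱ = (q^{-1/2}, q^{-3/2}, q^{-5/2}, …)`. -/
noncomputable def qRho (i : ℕ) : QSeries := qHalfPow (-(2 * (i : ℤ) + 1))

/-- `q^{μ+ϱ} = (q^{μ_1 - 1/2}, q^{μ_2 - 3/2}, q^{μ_3 - 5/2}, …)`. -/
noncomputable def qShiftRho (μ : YoungDiagram) (i : ℕ) : QSeries :=
  qHalfPow (2 * (μ.rowLen i : ℤ) - (2 * (i : ℤ) + 1))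

/-- The Hopf link invariant `W_{μ,ν}(q) = s_μ(q^ϱ) s_ν(q^{μ+ϱ})`. -/
noncomputable def hopfW (μ ν : YoungDiagram) : QSeries :=
  schur μ qRho * schur ν (qShiftRho μ)

/-- `κ_μ = ∑_{i ≥ 1} μ_i (μ_i - 2 i + 1)`. -/
def kappa (μ : YoungDiagram) : ℤ :=
  ∑ i ∈ Finset.range (μ.colLen 0), (μ.rowLen i : ℤ) * ((μ.rowLen i : ℤ) - 2 * ((i : ℤ) + 1) + 1)

/-- The summand of the partition function that belongs to `(μ¹, μ², μ³)`, a power series in `t`: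
`W_{μ¹,μ²} W_{μ²,μ³} W_{μ³,μ¹} q^{(κ_{μ¹} + κ_{μ²} + κ_{μ³}) / 2} (-t)^{|μ¹| + |μ²| + |μ³|}`. -/
noncomputable def partitionTerm (m : YoungDiagram × YoungDiagram × YoungDiagram) :
    PowerSeries QSeries :=
  PowerSeries.C (hopfW m.1 m.2.1 * hopfW m.2.1 m.2.2 * hopfW m.2.2 m.1 *
      qHalfPow (kappa m.1 + kappa m.2.1 + kappa m.2.2)) *
    (-PowerSeries.X) ^ (m.1.card + m.2.1.card + m.2.2.card)

/-- The topological partition function `Z` of local `ℙ²`, a power series in `t`. The sum over all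
triples of partitions is taken coefficient by coefficient in `t`; only finitely many triples
contribute to each coefficient, see `finite_support_coeff_partitionTerm`. -/
noncomputable def partitionZ : PowerSeries QSeries :=
  PowerSeries.mk fun d =>
    ∑ᶠ m : YoungDiagram × YoungDiagram × YoungDiagram, PowerSeries.coeff d (partitionTerm m)

/-- `I(d)`, the coefficient of `t ^ d` in `Z`. -/
noncomputable def coeffI (d : ℕ) : QSeries := PowerSeries.coeff d partitionZ

/-- `[∞]_{q⁻¹}! = ∏_{i ≥ 1} (1 - q^{-i})`. -/
noncomputable def qInfFactorial : QSeries := ∏' i : ℕ, (1 - qPow (-((i : ℤ) + 1)))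

/-- `∑_{i ≥ 1} q^{-i} / (1 - q^{-i})²`. -/
noncomputable def lambertSum : QSeries :=
  ∑' i : ℕ, qPow (-((i : ℤ) + 1)) / (1 - qPow (-((i : ℤ) + 1))) ^ 2

/- The infinite sums and products above converge, and the sum over triples of partitions is finite in
each degree. -/

theorem mem_of_nhds_zero {U : Set QSeries} (hU : U ∈ nhds 0) :
    ∃ N : ℤ, ∀ f : QSeries, (∀ n < N, f.coeff n = 0) → f ∈ U := by
  obtain ⟨γ, hγ⟩ := Valued.mem_nhds_zero.mp hU
  obtain ⟨x, hx⟩ := LaurentSeries.valuation_surjective (K := ℂ)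
    (MonoidWithZeroHom.ValueGroup₀.embedding γ.1)
  have hx0 : x ≠ 0 := by
    rintro rfl
    rw [map_zero] at hx
    exact γ.ne_zero (by simpa using hx.symm)
  have hv : (Valued.v x : WithZero (Multiplicative ℤ)) ≠ 0 := (Valuation.ne_zero_iff _).mpr hx0
  refine ⟨-WithZero.log (Valued.v x) + 1, fun f hf => hγ ?_⟩
  rw [Set.mem_ofPred_eq, Valuation.restrict_lt_iff_lt_embedding, ← hx]
  refine lt_of_le_of_lt ((LaurentSeries.valuation_le_iff_coeff_lt_eq_zero ℂ).mpr hf) ?_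
  rw [← WithZero.lt_log_iff_exp_lt hv]
  omega

theorem summable_of_coeff {ι : Type*} {f : ι → QSeries}
    (h : ∀ N : ℤ, {i | ¬ ∀ n < N, (f i).coeff n = 0}.Finite) : Summable f := by
  have : NonarchimedeanAddGroup QSeries :=
    ⟨fun U hU => by
      obtain ⟨γ, hγ⟩ := Valued.mem_nhds_zero.mp hU
      have hV : {x : QSeries | Valued.v.restrict x < (γ : _)} ∈ nhds (0 : QSeries) :=
        Valued.mem_nhds_zero.mpr ⟨γ, subset_rfl⟩
      exact ⟨⟨Valued.v.restrict.ltAddSubgroup γ,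
        AddSubgroup.isOpen_of_mem_nhds (H := Valued.v.restrict.ltAddSubgroup γ) (g := 0) hV⟩, hγ⟩⟩
  apply NonarchimedeanAddGroup.summable_of_tendsto_cofinite_zero
  intro U hU
  obtain ⟨N, hN⟩ := mem_of_nhds_zero hU
  rw [Filter.mem_map, Filter.mem_cofinite]
  exact (h N).subset fun i hi hi' => hi (hN _ hi')

theorem prod_map_single (e : ℕ → ℤ) (s : Multiset ℕ) :
    (s.map fun i => (HahnSeries.single (e i) 1 : QSeries)).prod =
      HahnSeries.single (s.map e).sum 1 := by
  induction s using Multiset.induction with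
  | empty => simp
  | cons a s ih => simp [ih, HahnSeries.single_mul_single]

theorem summable_monomials (μ : YoungDiagram) (k : ℕ) :
    Summable fun a : Sym ℕ k => ((a : Multiset ℕ).map (qShiftRho μ)).prod := by
  set c : ℤ := 2 * μ.rowLen 0 with hc
  set e : ℕ → ℤ := fun i => -(2 * (μ.rowLen i : ℤ) - (2 * (i : ℤ) + 1)) with he
  have hei : ∀ i : ℕ, (i : ℤ) - c ≤ e i := fun i => by
    have := μ.rowLen_anti 0 i (Nat.zero_le i)
    simp only [he, hc]; omega
  have hsum : ∀ s : Multiset ℕ, ((s.sum : ℕ) : ℤ) - c * (s.card : ℤ) ≤ (s.map e).sum := fun s => by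
    induction s using Multiset.induction with
    | empty => simp
    | cons a s ih =>
      simp only [Multiset.sum_cons, Multiset.card_cons, Multiset.map_cons]
      have := hei a
      rw [Nat.cast_add, Nat.cast_add, Nat.cast_one]
      linarith
  refine summable_of_coeff fun N => ?_
  have hfin : {s : Multiset ℕ | s.card = k ∧ s.sum ≤ (N + c * k).toNat}.Finite := by
    refine (Set.finite_range fun s : Sym (Fin ((N + c * k).toNat + 1)) k =>
      s.1.map Fin.val).subset ?_
    rintro s ⟨h1, h2⟩
    have hlt : ∀ i ∈ s, i < (N + c * k).toNat + 1 := fun i hi =>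
      Nat.lt_succ_of_le ((Multiset.single_le_sum (fun _ _ => Nat.zero_le _) i hi).trans h2)
    refine ⟨⟨s.pmap (fun i hi => ⟨i, hi⟩) hlt, by simp [h1]⟩, ?_⟩
    simp [Multiset.map_pmap, Multiset.pmap_eq_map]
  refine (hfin.preimage (f := fun a : Sym ℕ k => (a : Multiset ℕ)) Subtype.val_injective.injOn).subset
    fun a ha => ?_
  refine ⟨a.2, ?_⟩
  by_contra hlt
  apply ha
  intro n hn
  have h1 : ((a : Multiset ℕ).map (qShiftRho μ)).prod
      = HahnSeries.single ((a : Multiset ℕ).map e).sum 1 := prod_map_single e a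
  rw [h1, HahnSeries.coeff_single_of_ne]
  have h2 := hsum a
  have h3 : Multiset.card (a : Multiset ℕ) = k := a.2
  rw [h3] at h2
  have h4 : ¬ (a : Multiset ℕ).sum ≤ (N + c * k).toNat := hlt
  omega

theorem qShiftRho_bot : qShiftRho ⊥ = qRho := by
  funext i
  have : (⊥ : YoungDiagram).rowLen i = 0 := by
    rw [YoungDiagram.rowLen_eq_card]; simp [YoungDiagram.row]
  simp [qShiftRho, qRho, this]

theorem summable_monomials_qRho (k : ℕ) :
    Summable fun a : Sym ℕ k => ((a : Multiset ℕ).map qRho).prod :=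
  qShiftRho_bot ▸ summable_monomials ⊥ k

theorem multipliable_qInfFactorial :
    Multipliable fun i : ℕ => (1 - qPow (-((i : ℤ) + 1)) : QSeries) := by
  simp_rw [sub_eq_add_neg]
  refine multipliable_one_add_of_summable_prod (summable_of_coeff fun N => ?_)
  refine ((Finset.range N.toNat).powerset.finite_toSet).subset fun s hs => ?_
  simp only [Finset.coe_powerset, Set.mem_preimage, Set.mem_powerset_iff, Finset.coe_subset]
  intro i hi
  rw [Finset.mem_range]
  by_contra hlt
  apply hs
  intro n hn
  have key : ∏ j ∈ s, -qPow (-((j : ℤ) + 1)) =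
    (-1) ^ s.card * (HahnSeries.single (∑ j ∈ s, 2 * ((j : ℤ) + 1)) 1 : QSeries) := by
    clear hs hi
    induction s using Finset.induction with
    | empty => simp
    | insert a s ha ih =>
      rw [Finset.prod_insert ha, ih, Finset.sum_insert ha, Finset.card_insert_of_notMem ha, qPow,
        qHalfPow, ← one_mul (1 : ℂ), ← HahnSeries.single_mul_single, pow_succ, one_mul, mul_neg,
        neg_neg]
      ring
  have h2 : (2 * ((i : ℤ) + 1)) ≤ ∑ j ∈ s, 2 * ((j : ℤ) + 1) :=
    Finset.single_le_sum (f := fun j : ℕ => 2 * ((j : ℤ) + 1)) (fun j _ => by positivity) hi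
  rw [key]
  rcases neg_one_pow_eq_or QSeries s.card with h | h <;> rw [h] <;>
    simp only [one_mul, neg_mul, HahnSeries.coeff_neg, neg_eq_zero] <;>
    exact HahnSeries.coeff_single_of_ne (by omega)

theorem summable_lambertSum :
    Summable fun i : ℕ =>
      (qPow (-((i : ℤ) + 1)) / (1 - qPow (-((i : ℤ) + 1))) ^ 2 : QSeries) := by
  refine summable_of_coeff fun N => ?_
  refine (Finset.range N.toNat).finite_toSet.subset fun i hi => ?_
  rw [Finset.mem_coe, Finset.mem_range]
  by_contra hlt
  apply hi
  intro n hn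
  have hq : Valued.v (qPow (-((i : ℤ) + 1)) : QSeries) = WithZero.exp (-(2 * ((i : ℤ) + 1))) := by
    rw [qPow, qHalfPow, LaurentSeries.valuation_single_zpow]; ring_nf
  have h1 : Valued.v (1 - qPow (-((i : ℤ) + 1)) : QSeries) = 1 := by
    apply Valuation.map_one_sub_of_lt
    rw [hq, ← WithZero.exp_zero, WithZero.exp_lt_exp]; omega
  refine (LaurentSeries.valuation_le_iff_coeff_lt_eq_zero ℂ (D := N)).mp ?_ n hn
  rw [map_div₀, map_pow, h1, hq, one_pow, div_one, WithZero.exp_le_exp]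
  omega

theorem finite_triples (d : ℕ) :
    {m : YoungDiagram × YoungDiagram × YoungDiagram |
      m.1.card + m.2.1.card + m.2.2.card = d}.Finite := by
  have key : {μ : YoungDiagram | μ.card ≤ d}.Finite := by
    refine Set.Finite.of_finite_image (f := YoungDiagram.cells) ?_ ?_
    · refine ((Finset.range d ×ˢ Finset.range d).powerset.finite_toSet).subset ?_
      rintro _ ⟨μ, hμ, rfl⟩
      simp only [Finset.coe_powerset, Set.mem_preimage, Set.mem_powerset_iff, Finset.coe_subset]
      rintro ⟨i, j⟩ hij
      have h1 : μ.rowLen i ≤ μ.card := by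
        rw [YoungDiagram.rowLen_eq_card]; exact Finset.card_le_card (Finset.filter_subset _ _)
      have h2 : μ.colLen j ≤ μ.card := by
        rw [YoungDiagram.colLen_eq_card]; exact Finset.card_le_card (Finset.filter_subset _ _)
      have hij' : (i, j) ∈ μ := hij
      have h3 := YoungDiagram.mem_iff_lt_rowLen.mp hij'
      have h4 := YoungDiagram.mem_iff_lt_colLen.mp hij'
      have h5 : μ.card ≤ d := hμ
      simp only [Finset.mem_product, Finset.mem_range]
      omega
    · intro a _ b _ h; exact YoungDiagram.ext h
  refine (key.prod (key.prod key)).subset ?_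
  rintro ⟨a, b, c⟩ h
  simp only [Set.mem_ofPred_eq] at h
  simp only [Set.mem_prod, Set.mem_ofPred_eq]
  omega

theorem finite_support_coeff_partitionTerm (d : ℕ) :
    (Function.support fun m => PowerSeries.coeff d (partitionTerm m)).Finite := by
  refine (finite_triples d).subset fun m hm => ?_
  by_contra h
  apply hm
  have h' : d ≠ m.1.card + m.2.1.card + m.2.2.card := fun e => h e.symm
  simp only [partitionTerm, neg_pow (PowerSeries.X : PowerSeries QSeries)]
  rw [PowerSeries.coeff_C_mul, ← map_one PowerSeries.C, ← map_neg, ← map_pow,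
    PowerSeries.coeff_C_mul, PowerSeries.coeff_X_pow, if_neg h', mul_zero, mul_zero]

end LocalP2

/-! Write x = q⁻¹, X = [∞]!, L = `lambertSum`, and measure orders in u = q^(-1/2). The claim is then
an equality modulo `ordGE (4 * d)`.

Let l_i be the sum of the i-th parts (i ≥ 0) of the three partitions, and let k = d - l_0 count the
boxes below the first rows. The Jacobi–Trudi determinant shows that the normalized summand has order
at least d² - 3d + ∑ ((6i + 3) l_i - l_i²) ≥ 2 k l_0 + 6 k, which is at least 4d once k ≥ 2
(`hopfTriple_mem_ordGE`). Hence only triples of one-row partitions (k = 0) and triples with one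
partition (a + 1, 1) and two one-row partitions (k = 1) matter (`sum_hopfTriple_sub_mem_ordGE`).

For these the Hopf link invariants are explicit. Up to monomials they are (1 - δ(a,b)) / X for two
rows and (1 - η(a,b)) / ((1 - x) X) for a hook and a row, where δ = `rowDefect` and η = `hookDefect`
have order at least 2(a + 1)(b + 1). In the expanded products over triples most products of defects
are negligible. Euler's identity gives ∑ δ = L, and on the edge δ(0,b) = x^(b+1) (1 - ε_b) / (1 - x)
with ε = `edgeDefect` small; similarly ∑ η = L - ∑ ε. With P = x^(d+2) / (1 - x)², modulo the
allowed error, X³ times the contribution is rows: C(d+2, 2) - 3 (L - 2P) + 3P (d + 1 - 2 ∑ ε),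
hooks: 3P (C(d, 2) - L - 2 (L - ∑ ε)). The unknown ∑ ε cancels, and d + C(d, 2) = C(d+1, 2) yields
the stated formula. -/

namespace LocalP2

open Filter Topology

/-! ### Orders of series and convergence. -/

/-- The additive group of series all of whose exponents in `u = q ^ (-1/2)` are at least `N`. -/
def ordGE (N : ℤ) : AddSubgroup QSeries where
  carrier := {f | ∀ n < N, f.coeff n = 0}
  add_mem' hf hg n hn := by rw [HahnSeries.coeff_add, hf n hn, hg n hn, add_zero]
  zero_mem' n _ := rfl
  neg_mem' hf n hn := by rw [HahnSeries.coeff_neg, hf n hn, neg_zero]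

theorem mem_ordGE_iff_valuation {N : ℤ} {f : QSeries} :
    f ∈ ordGE N ↔ Valued.v f ≤ WithZero.exp (-N) :=
  (LaurentSeries.valuation_le_iff_coeff_lt_eq_zero ℂ).symm

theorem ordGE_anti {M N : ℤ} (h : M ≤ N) : ordGE N ≤ ordGE M :=
  fun _ hf n hn => hf n (hn.trans_le h)

theorem mul_mem_ordGE {M N : ℤ} {f g : QSeries} (hf : f ∈ ordGE M) (hg : g ∈ ordGE N) :
    f * g ∈ ordGE (M + N) := by
  rw [mem_ordGE_iff_valuation] at *
  rw [map_mul, neg_add, WithZero.exp_add]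
  exact mul_le_mul' hf hg

theorem single_mem_ordGE {N n : ℤ} (h : N ≤ n) (c : ℂ) :
    (HahnSeries.single n c : QSeries) ∈ ordGE N :=
  fun _ hm => HahnSeries.coeff_single_of_ne (by omega)

theorem one_mem_ordGE : (1 : QSeries) ∈ ordGE 0 := single_mem_ordGE le_rfl 1

theorem natCast_mem_ordGE (n : ℕ) : (n : QSeries) ∈ ordGE 0 := by
  induction n with
  | zero => simp
  | succ n ih => simpa using (ordGE 0).add_mem ih one_mem_ordGE

theorem mul_mem_ordGE_left {N : ℤ} {f g : QSeries} (hf : f ∈ ordGE 0) (hg : g ∈ ordGE N) :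
    f * g ∈ ordGE N := by simpa using mul_mem_ordGE hf hg

theorem mul_mem_ordGE_right {N : ℤ} {f g : QSeries} (hf : f ∈ ordGE N) (hg : g ∈ ordGE 0) :
    f * g ∈ ordGE N := by simpa using mul_mem_ordGE hf hg

theorem pow_mem_ordGE {f : QSeries} (hf : f ∈ ordGE 0) (k : ℕ) : f ^ k ∈ ordGE 0 := by
  induction k with
  | zero => simpa using one_mem_ordGE
  | succ k ih => rw [pow_succ]; exact mul_mem_ordGE_left ih hf

theorem prod_mem_ordGE {ι : Type*} (s : Finset ι) {f : ι → QSeries} {e : ι → ℤ}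
    (h : ∀ i ∈ s, f i ∈ ordGE (e i)) : ∏ i ∈ s, f i ∈ ordGE (∑ i ∈ s, e i) := by
  classical
  induction s using Finset.induction with
  | empty => simpa using one_mem_ordGE
  | insert a s ha ih =>
    rw [Finset.prod_insert ha, Finset.sum_insert ha]
    exact mul_mem_ordGE (h _ (Finset.mem_insert_self _ _))
      (ih fun i hi => h i (Finset.mem_insert_of_mem hi))

theorem multiset_prod_mem_ordGE {ι : Type*} (s : Multiset ι) {f : ι → QSeries} {e : ι → ℤ}
    (h : ∀ i ∈ s, f i ∈ ordGE (e i)) : (s.map f).prod ∈ ordGE (s.map e).sum := by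
  induction s using Multiset.induction with
  | empty => simpa using one_mem_ordGE
  | cons a s ih =>
    simp only [Multiset.map_cons, Multiset.prod_cons, Multiset.sum_cons]
    exact mul_mem_ordGE (h _ (Multiset.mem_cons_self _ _))
      (ih fun i hi => h i (Multiset.mem_cons_of_mem hi))

theorem ordGE_mem_nhds_zero (N : ℤ) : (ordGE N : Set QSeries) ∈ 𝓝 (0 : QSeries) := by
  have h0 : (HahnSeries.single N 1 : QSeries) ≠ 0 := by simp
  have h : 0 < Valued.v.restrict (HahnSeries.single N 1 : QSeries) :=
    (Valuation.restrict_pos_iff _ _).mpr ((Valuation.pos_iff _).mpr h0)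
  refine Valued.mem_nhds_zero.mpr ⟨Units.mk0 _ h.ne', fun f hf => ?_⟩
  rw [Set.mem_ofPred_eq, Units.val_mk0, Valuation.restrict_lt_iff] at hf
  rw [SetLike.mem_coe, mem_ordGE_iff_valuation, ← LaurentSeries.valuation_single_zpow (K := ℂ)]
  exact hf.le

instance : NonarchimedeanRing QSeries where
  is_nonarchimedean U hU := by
    obtain ⟨N, hN⟩ := mem_of_nhds_zero hU
    exact ⟨⟨ordGE N, AddSubgroup.isOpen_of_mem_nhds _ (ordGE_mem_nhds_zero N)⟩, hN⟩

theorem isClosed_ordGE (N : ℤ) : IsClosed (ordGE N : Set QSeries) :=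
  AddSubgroup.isClosed_of_isOpen _ (AddSubgroup.isOpen_of_mem_nhds _ (ordGE_mem_nhds_zero N))

theorem tendsto_of_sub_mem_ordGE {ι : Type*} {l : Filter ι} {f : ι → QSeries} {a : QSeries}
    (h : ∀ N : ℤ, ∀ᶠ i in l, f i - a ∈ ordGE N) : Tendsto f l (𝓝 a) := by
  rw [← tendsto_sub_nhds_zero_iff]
  intro U hU
  obtain ⟨N, hN⟩ := mem_of_nhds_zero hU
  exact (h N).mono fun i hi => hN _ hi

theorem tsum_mem_ordGE {ι : Type*} {N : ℤ} {f : ι → QSeries} (h : ∀ i, f i ∈ ordGE N) :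
    ∑' i, f i ∈ ordGE N := by
  by_cases hf : Summable f
  · exact (isClosed_ordGE N).mem_of_tendsto hf.hasSum
      (Eventually.of_forall fun s => sum_mem fun i _ => h i)
  · rw [tsum_eq_zero_of_not_summable hf]; exact zero_mem _

theorem summable_of_mem_ordGE {ι : Type*} {f : ι → QSeries} (e : ι → ℤ)
    (h : ∀ i, f i ∈ ordGE (e i)) (he : ∀ N : ℤ, {i | e i < N}.Finite) : Summable f :=
  summable_of_coeff fun N => (he N).subset fun i hi => by
    by_contra hlt
    exact hi (ordGE_anti (not_lt.mp hlt) (h i))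

theorem finite_nat_lt_of_le {e : ℕ → ℤ} (h : ∀ i : ℕ, (i : ℤ) ≤ e i) (N : ℤ) :
    {i | e i < N}.Finite :=
  (Finset.range N.toNat).finite_toSet.subset fun i hi => by
    have := h i
    simp only [Set.mem_ofPred_eq] at hi
    simp only [Finset.coe_range, Set.mem_Iio]
    omega

theorem finite_nat_prod_lt_of_le {e : ℕ × ℕ → ℤ} (h : ∀ i : ℕ × ℕ, (i.1 : ℤ) + i.2 ≤ e i) (N : ℤ) :
    {i | e i < N}.Finite :=
  (Finset.range N.toNat ×ˢ Finset.range N.toNat).finite_toSet.subset fun i hi => by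
    have := h i
    simp only [Set.mem_ofPred_eq] at hi
    simp only [Finset.coe_product, Finset.coe_range, Set.mem_prod, Set.mem_Iio]
    omega

/-- Telescoping series. -/
theorem hasSum_of_telescope {S r : ℕ → QSeries} (hr : ∀ a : ℕ, r a ∈ ordGE a)
    (hS : ∀ a : ℕ, S a ∈ ordGE a) (h : ∀ a, S (a + 1) = S a - r a) (m : ℕ) :
    HasSum (fun k => r (m + k)) (S m) := by
  have hsum : Summable fun k => r (m + k) :=
    summable_of_mem_ordGE (fun k : ℕ => (k : ℤ)) (fun k => ordGE_anti (by push_cast; omega) (hr _))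
      (finite_nat_lt_of_le fun _ => le_rfl)
  have hpart : ∀ n, ∑ k ∈ Finset.range n, r (m + k) = S m - S (m + n) := fun n => by
    induction n with
    | zero => simp
    | succ n ih => rw [Finset.sum_range_succ, ih, ← add_assoc, h]; ring
  have hlim : Tendsto (fun n => ∑ k ∈ Finset.range n, r (m + k)) atTop (𝓝 (S m)) := by
    refine tendsto_of_sub_mem_ordGE fun N => eventually_atTop.mpr ⟨N.toNat, fun n hn => ?_⟩
    rw [hpart, sub_sub_cancel_left]
    exact neg_mem (ordGE_anti (by push_cast; omega) (hS (m + n)))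
  rw [← tendsto_nhds_unique hsum.hasSum.tendsto_sum_nat hlim]
  exact hsum.hasSum

theorem qHalfPow_mul (m n : ℤ) : qHalfPow m * qHalfPow n = qHalfPow (m + n) := by
  simp only [qHalfPow, HahnSeries.single_mul_single, mul_one, qHalfPow, neg_add]

theorem qHalfPow_zero : qHalfPow 0 = 1 := rfl

theorem qHalfPow_ne_zero (n : ℤ) : qHalfPow n ≠ 0 := by simp [qHalfPow]

theorem qHalfPow_pow (m : ℤ) (k : ℕ) : qHalfPow m ^ k = qHalfPow (m * k) := by
  induction k with
  | zero => simp [qHalfPow_zero]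
  | succ k ih => rw [pow_succ, ih, qHalfPow_mul]; push_cast; ring_nf

theorem qHalfPow_mem_ordGE {N n : ℤ} (h : N ≤ -n) : qHalfPow n ∈ ordGE N := single_mem_ordGE h 1

/-! ### Powers of q⁻¹ and q-factorials. -/

/-- `x = q⁻¹`. -/
noncomputable def qInv : QSeries := qHalfPow (-2)

theorem qInv_pow (k : ℕ) : qInv ^ k = qHalfPow (-(2 * k)) := by
  rw [qInv, qHalfPow_pow]; ring_nf

theorem qPow_eq_qInv_pow {n : ℤ} {k : ℕ} (h : n = -k) : qPow n = qInv ^ k := by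
  rw [qInv_pow, qPow, h]; ring_nf

theorem qInv_ne_zero : qInv ≠ 0 := qHalfPow_ne_zero _

theorem qInv_pow_mem_ordGE {N : ℤ} {k : ℕ} (h : N ≤ 2 * k) : qInv ^ k ∈ ordGE N := by
  rw [qInv_pow]; exact qHalfPow_mem_ordGE (by omega)

theorem qInv_pow_mem_ordGE_zero (k : ℕ) : qInv ^ k ∈ ordGE 0 := qInv_pow_mem_ordGE (by omega)

theorem valuation_one_sub_qInv_pow (k : ℕ) : Valued.v (1 - qInv ^ (k + 1)) = 1 := by
  apply Valuation.map_one_sub_of_lt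
  rw [qInv_pow, qHalfPow, LaurentSeries.valuation_single_zpow, ← WithZero.exp_zero,
    WithZero.exp_lt_exp]
  push_cast; omega

theorem one_sub_qInv_pow_ne_zero (k : ℕ) : (1 - qInv ^ (k + 1)) ≠ 0 := fun h => by
  have := valuation_one_sub_qInv_pow k
  simp [h] at this

theorem one_sub_qInv_ne_zero : 1 - qInv ≠ 0 := by simpa using one_sub_qInv_pow_ne_zero 0

theorem inv_one_sub_mem_ordGE (k : ℕ) : (1 - qInv ^ (k + 1))⁻¹ ∈ ordGE 0 := by
  rw [mem_ordGE_iff_valuation, map_inv₀, valuation_one_sub_qInv_pow]; simp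

theorem inv_one_sub_qInv_mem_ordGE : (1 - qInv)⁻¹ ∈ ordGE 0 := by
  simpa using inv_one_sub_mem_ordGE 0

theorem one_sub_qInv_pow_mem_ordGE (k : ℕ) : 1 - qInv ^ k ∈ ordGE 0 :=
  sub_mem one_mem_ordGE (qInv_pow_mem_ordGE_zero k)

theorem one_sub_qInv_mem_ordGE : 1 - qInv ∈ ordGE 0 := by simpa using one_sub_qInv_pow_mem_ordGE 1

/-- The geometric series. -/
theorem hasSum_qInv_pow (k : ℕ) :
    HasSum (fun j : ℕ => (qInv ^ (k + 1)) ^ j) (1 - qInv ^ (k + 1))⁻¹ := by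
  have := hasSum_of_telescope (S := fun j => (qInv ^ (k + 1)) ^ j * (1 - qInv ^ (k + 1))⁻¹)
    (r := fun j => (qInv ^ (k + 1)) ^ j)
    (fun a => by rw [← pow_mul]; exact qInv_pow_mem_ordGE (by push_cast; nlinarith))
    (fun a => by
      rw [← pow_mul]
      exact mul_mem_ordGE_right (qInv_pow_mem_ordGE (by push_cast; nlinarith))
        (inv_one_sub_mem_ordGE k))
    (fun a => by have := one_sub_qInv_pow_ne_zero k; field_simp; ring) 0
  simpa using this

/-- `(x; x)_n = (1 - x) (1 - x²) ⋯ (1 - xⁿ)`. -/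
noncomputable def qFact (n : ℕ) : QSeries := ∏ i ∈ Finset.range n, (1 - qInv ^ (i + 1))

@[simp] theorem qFact_zero : qFact 0 = 1 := rfl

theorem qFact_succ (n : ℕ) : qFact (n + 1) = qFact n * (1 - qInv ^ (n + 1)) :=
  Finset.prod_range_succ _ _

theorem qFact_one : qFact 1 = 1 - qInv := by simp [qFact_succ]

theorem valuation_qFact (n : ℕ) : Valued.v (qFact n) = 1 := by
  induction n with
  | zero => simp
  | succ n ih => rw [qFact_succ, map_mul, ih, valuation_one_sub_qInv_pow, one_mul]

theorem qFact_ne_zero (n : ℕ) : qFact n ≠ 0 := fun h => by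
  have := valuation_qFact n
  simp [h] at this

theorem qFact_mem_ordGE (n : ℕ) : qFact n ∈ ordGE 0 := by
  rw [mem_ordGE_iff_valuation, valuation_qFact]; simp

theorem inv_qFact_mem_ordGE (n : ℕ) : (qFact n)⁻¹ ∈ ordGE 0 := by
  rw [mem_ordGE_iff_valuation, map_inv₀, valuation_qFact]; simp

theorem tendsto_qFact : Tendsto qFact atTop (𝓝 qInfFactorial) := by
  have := multipliable_qInfFactorial.hasProd.tendsto_prod_nat
  refine this.congr fun n => Finset.prod_congr rfl fun i _ => ?_
  rw [qPow_eq_qInv_pow (k := i + 1) (by push_cast; ring)]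

theorem qInfFactorial_mem_ordGE : qInfFactorial ∈ ordGE 0 :=
  (isClosed_ordGE 0).mem_of_tendsto tendsto_qFact (Eventually.of_forall qFact_mem_ordGE)

/-! ### Complete homogeneous functions and the order of Schur functions. -/

/-- Sequences of series whose orders grow at least linearly; these are the arguments at which the
complete homogeneous symmetric functions converge. -/
def LinearGrowth (y : ℕ → QSeries) : Prop := ∃ c : ℤ, ∀ i : ℕ, y i ∈ ordGE (i - c)

theorem finite_multiset_sum_le (k M : ℕ) :
    {s : Multiset ℕ | s.card = k ∧ s.sum ≤ M}.Finite := by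
  refine (Set.finite_range fun s : Sym (Fin (M + 1)) k => s.1.map Fin.val).subset ?_
  rintro s ⟨h1, h2⟩
  have hlt : ∀ i ∈ s, i < M + 1 := fun i hi =>
    Nat.lt_succ_of_le ((Multiset.single_le_sum (fun _ _ => Nat.zero_le _) i hi).trans h2)
  refine ⟨⟨s.pmap (fun i hi => ⟨i, hi⟩) hlt, by simp [h1]⟩, ?_⟩
  simp [Multiset.map_pmap, Multiset.pmap_eq_map]

theorem LinearGrowth.summable {y : ℕ → QSeries} (hy : LinearGrowth y) (k : ℕ) :
    Summable fun a : Sym ℕ k => ((a : Multiset ℕ).map y).prod := by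
  obtain ⟨c, hc⟩ := hy
  refine summable_of_mem_ordGE (fun a : Sym ℕ k => ((a : Multiset ℕ).map fun i : ℕ => (i : ℤ) - c).sum)
    (fun a => multiset_prod_mem_ordGE _ fun i _ => hc i) fun N => ?_
  refine ((finite_multiset_sum_le k (N + c * k).toNat).preimage
    (f := fun a : Sym ℕ k => (a : Multiset ℕ)) Subtype.val_injective.injOn).subset fun a ha => ?_
  have hsum : ∀ s : Multiset ℕ,
      (s.map fun i : ℕ => (i : ℤ) - c).sum = (s.sum : ℤ) - c * (s.card : ℤ) := fun s => by
    induction s using Multiset.induction with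
    | empty => simp
    | cons a s ih =>
      simp only [Multiset.sum_cons, Multiset.card_cons, Multiset.map_cons, ih]
      push_cast; ring
  have h3 : Multiset.card (a : Multiset ℕ) = k := a.2
  simp only [Set.mem_ofPred_eq, hsum, h3] at ha
  exact ⟨h3, show (a : Multiset ℕ).sum ≤ _ by omega⟩

theorem LinearGrowth.shift {y : ℕ → QSeries} (hy : LinearGrowth y) :
    LinearGrowth fun i => y (i + 1) := by
  obtain ⟨c, hc⟩ := hy
  exact ⟨c, fun i => ordGE_anti (by push_cast; omega) (hc (i + 1))⟩

theorem LinearGrowth.shift_add {y : ℕ → QSeries} (hy : LinearGrowth y) (m : ℕ) :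
    LinearGrowth fun i => y (i + m) := by
  obtain ⟨c, hc⟩ := hy
  exact ⟨c, fun i => ordGE_anti (by push_cast; omega) (hc (i + m))⟩

theorem linearGrowth_qShiftRho (μ : YoungDiagram) : LinearGrowth (qShiftRho μ) :=
  ⟨2 * μ.rowLen 0, fun i => qHalfPow_mem_ordGE (by
    have := μ.rowLen_anti 0 i (Nat.zero_le i)
    omega)⟩

/-- A multiset of indices either contains 0, which can be removed once, or consists of successors.
This splits off the first variable in `hsymm_succ`. -/
theorem bijective_symNat (k : ℕ) : Function.Bijective
    (Sum.elim (fun s : Sym ℕ k => 0 ::ₛ s) fun s : Sym ℕ (k + 1) => s.map Nat.succ) := by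
  refine ⟨Function.Injective.sumElim (fun s t h => (Sym.cons_inj_right 0 s t).mp h)
    (Sym.map_injective Nat.succ_injective _) fun s t h => ?_, fun s => ?_⟩
  · have : 0 ∈ Sym.map Nat.succ t := h ▸ Sym.mem_cons_self 0 s
    obtain ⟨i, -, hi⟩ := Sym.mem_map.mp this
    exact Nat.succ_ne_zero i hi
  · by_cases h : 0 ∈ s
    · exact ⟨.inl (s.erase 0 h), by simp⟩
    · refine ⟨.inr (s.map Nat.pred), ?_⟩
      simp only [Sum.elim_inr, Sym.map_map]
      conv_rhs => rw [← Sym.map_id' s]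
      exact Sym.map_congr fun i hi => Nat.succ_pred fun h0 => h (h0 ▸ hi)

theorem hsymm_zero (y : ℕ → QSeries) : hsymm y 0 = 1 := by
  rw [hsymm, tsum_eq_single (default : Sym ℕ 0) fun b hb => (hb (Subsingleton.elim _ _)).elim]
  rfl

theorem hsymm_succ {y : ℕ → QSeries} (hy : LinearGrowth y) (k : ℕ) :
    hsymm y (k + 1) = hsymm (fun i => y (i + 1)) (k + 1) + y 0 * hsymm y k := by
  have h1 := ((hy.summable k).hasSum).mul_left (y 0)
  have h2 := (hy.shift.summable (k + 1)).hasSum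
  have h3 := (Equiv.ofBijective _ (bijective_symNat k)).hasSum_iff
    (f := fun a : Sym ℕ (k + 1) => ((a : Multiset ℕ).map y).prod)
    (a := y 0 * hsymm y k + hsymm (fun i => y (i + 1)) (k + 1))
  rw [add_comm (hsymm _ (k + 1))]
  refine (h3.mp (HasSum.sum ?_ ?_)).tsum_eq
  · convert! h1 using 2 with a
    exact (congrArg (fun s => (Multiset.map y s).prod) (Sym.coe_cons a 0)).trans (by simp)
  · convert! h2 using 2 with a
    simp

theorem hsymm_smul (c : QSeries) (y : ℕ → QSeries) (k : ℕ) :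
    hsymm (fun i => c * y i) k = c ^ k * hsymm y k := by
  rw [hsymm, hsymm, ← tsum_mul_left]
  refine tsum_congr fun a => ?_
  rw [Multiset.prod_map_mul]
  simp

theorem hsymm_mem_ordGE {y : ℕ → QSeries} {e : ℤ} (h : ∀ i, y i ∈ ordGE e) (k : ℕ) :
    hsymm y k ∈ ordGE (k * e) :=
  tsum_mem_ordGE fun a => by
    have := multiset_prod_mem_ordGE (a : Multiset ℕ) (f := y) (e := fun _ => e) fun i _ => h i
    simpa using this

theorem hsymmInt_natCast (y : ℕ → QSeries) (k : ℕ) : hsymmInt y k = hsymm y k := by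
  simp [hsymmInt]

theorem hsymmInt_of_neg (y : ℕ → QSeries) {k : ℤ} (h : k < 0) : hsymmInt y k = 0 :=
  if_neg (by omega)

theorem hsymmInt_eq {y : ℕ → QSeries} (hy : LinearGrowth y) (k : ℤ) :
    hsymmInt y k = hsymmInt (fun i => y (i + 1)) k + y 0 * hsymmInt y (k - 1) := by
  rcases lt_trichotomy k 0 with h | rfl | h
  · rw [hsymmInt_of_neg _ h, hsymmInt_of_neg _ h, hsymmInt_of_neg _ (by omega)]; simp
  · rw [hsymmInt_of_neg _ (show (0 : ℤ) - 1 < 0 by omega)]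
    simp [hsymmInt, hsymm_zero]
  · obtain ⟨n, rfl⟩ : ∃ n : ℕ, k = (n + 1 : ℕ) := ⟨k.toNat - 1, by omega⟩
    rw [hsymmInt_natCast, hsymmInt_natCast, hsymm_succ hy,
      show ((n + 1 : ℕ) : ℤ) - 1 = (n : ℕ) by push_cast; ring, hsymmInt_natCast]

theorem hsymmInt_mem_ordGE {y : ℕ → QSeries} {e : ℤ} (h : ∀ i, y i ∈ ordGE e) (k : ℤ) :
    hsymmInt y k ∈ ordGE (k * e) := by
  rcases lt_or_ge k 0 with hk | hk
  · rw [hsymmInt_of_neg _ hk]; exact zero_mem _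
  · lift k to ℕ using hk
    rw [hsymmInt_natCast]
    exact hsymm_mem_ordGE h k

/-- The Jacobi–Trudi determinant is unchanged when the first `j` variables are dropped in
column `j`. -/
theorem det_hsymmInt_eq_det_shift {y : ℕ → QSeries} (hy : LinearGrowth y) (n : ℕ) (p : Fin n → ℤ) :
    (Matrix.of fun i j : Fin n => hsymmInt y (p i + (j : ℤ))).det =
      (Matrix.of fun i j : Fin n => hsymmInt (fun l => y (l + j)) (p i + (j : ℤ))).det := by
  cases n with
  | zero => simp
  | succ n =>
    have key : ∀ m : ℕ, (Matrix.of fun i j : Fin (n + 1) => hsymmInt y (p i + (j : ℤ))).det =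
        (Matrix.of fun i j : Fin (n + 1) =>
          hsymmInt (fun l => y (l + min (j : ℕ) m)) (p i + (j : ℤ))).det := fun m => by
      induction m with
      | zero => simp
      | succ m ih =>
        rw [ih]
        -- Dropping `y m` from column `j + 1` with `m ≤ j` is subtracting `y m` times column `j`, by
        -- `hsymmInt_eq`.
        refine Matrix.det_eq_of_forall_col_eq_smul_add_pred
          (fun j => if m ≤ j then y m else 0) (fun i => by simp) fun i j => ?_
        simp only [Matrix.of_apply, Fin.val_succ, Fin.val_castSucc]
        split_ifs with h
        · rw [min_eq_right (by omega), min_eq_right (by omega), min_eq_right h,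
            hsymmInt_eq (hy.shift_add m)]
          simp only [zero_add]
          congr 2
          · funext l; congr 1; omega
          · congr 1; push_cast; ring
        · rw [min_eq_left (by omega), min_eq_left (by omega)]; simp
    rw [key (n + 1)]
    congr 2
    funext i j
    rw [min_eq_left (by omega)]

/-- Compares the order of the Leibniz term of `σ` with the diagonal one: `r i - i` decreases and `e`
increases, so the rearrangement inequality applies after cancelling `∑ i * e i`. -/
theorem sum_le_sum_rearrange {n : ℕ} (r e : Fin n → ℤ) (hr : Antitone r) (he : Monotone e)
    (σ : Equiv.Perm (Fin n)) :
    ∑ i, r i * e i ≤ ∑ i, (r (σ i) - (σ i : ℤ) + i) * e i := by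
  have hf : Antitone fun i : Fin n => r i - (i : ℤ) := fun i j hij => by
    have h1 := hr hij
    have h2 : ((i : ℕ) : ℤ) ≤ (j : ℕ) := by exact_mod_cast hij
    simp only; omega
  have := (hf.antivary he).sum_smul_le_sum_comp_perm_smul (σ := σ)
  simp only [smul_eq_mul] at this
  simp only [add_mul, sub_mul, Finset.sum_add_distrib, Finset.sum_sub_distrib] at this ⊢
  linarith

/-- The order of a Schur function at arguments of nondecreasing order. -/
theorem schur_mem_ordGE {y : ℕ → QSeries} (hy : LinearGrowth y) {e : ℕ → ℤ} (he : Monotone e)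
    (h : ∀ i, y i ∈ ordGE (e i)) (μ : YoungDiagram) :
    schur μ y ∈ ordGE (∑ i ∈ Finset.range (μ.colLen 0), (μ.rowLen i : ℤ) * e i) := by
  -- In the original matrix every entry involves the variable of lowest order, and the bound holds
  -- only through cancellation. After the shift, column `j` uses variables of order at least `e j`,
  -- and each Leibniz term satisfies the bound.
  rw [schur, det_hsymmInt_eq_det_shift hy _ fun i => (μ.rowLen i : ℤ) - (i : ℤ), Matrix.det_apply,
    ← Fin.sum_univ_eq_sum_range fun i => (μ.rowLen i : ℤ) * e i]
  refine sum_mem fun σ _ => ?_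
  have hprod := prod_mem_ordGE Finset.univ (f := fun i : Fin (μ.colLen 0) =>
    hsymmInt (fun l => y (l + i)) ((μ.rowLen (σ i) : ℤ) - (σ i : ℤ) + (i : ℤ)))
    (e := fun i => ((μ.rowLen (σ i) : ℤ) - (σ i : ℤ) + (i : ℤ)) * e i) fun i _ =>
      hsymmInt_mem_ordGE (fun l => ordGE_anti (he (Nat.le_add_left _ _)) (h _)) _
  have hle := sum_le_sum_rearrange (fun i : Fin (μ.colLen 0) => (μ.rowLen i : ℤ))
    (fun i => e i) (fun i j hij => Int.ofNat_le.mpr (μ.rowLen_anti i j hij))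
    (fun i j hij => he hij) σ
  have hmem := ordGE_anti hle hprod
  rcases Int.units_eq_one_or (Equiv.Perm.sign σ) with hs | hs <;> rw [hs]
  · simpa using hmem
  · simpa using hmem

/-! ### Order of the summands of the partition function. -/

theorem lt_colLen_zero_iff {μ : YoungDiagram} {i : ℕ} : i < μ.colLen 0 ↔ 0 < μ.rowLen i := by
  rw [← YoungDiagram.mem_iff_lt_colLen, YoungDiagram.mem_iff_lt_rowLen]

theorem rowLen_eq_zero {μ : YoungDiagram} {i : ℕ} (h : μ.colLen 0 ≤ i) : μ.rowLen i = 0 := by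
  have := lt_colLen_zero_iff (μ := μ) (i := i)
  omega

theorem youngDiagram_ext {μ ν : YoungDiagram} (h : ∀ i, μ.rowLen i = ν.rowLen i) : μ = ν := by
  ext ⟨i, j⟩
  rw [YoungDiagram.mem_cells, YoungDiagram.mem_cells, YoungDiagram.mem_iff_lt_rowLen,
    YoungDiagram.mem_iff_lt_rowLen, h]

theorem card_eq_sum_rowLen {μ : YoungDiagram} {K : ℕ} (h : μ.colLen 0 ≤ K) :
    μ.card = ∑ i ∈ Finset.range K, μ.rowLen i := by
  rw [YoungDiagram.card, Finset.card_eq_sum_card_fiberwise (f := Prod.fst) (t := Finset.range K)]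
  · exact Finset.sum_congr rfl fun i _ => (μ.rowLen_eq_card).symm
  · rintro ⟨i, j⟩ hc
    have h1 := μ.colLen_anti 0 j (Nat.zero_le j)
    have h2 := YoungDiagram.mem_iff_lt_colLen.mp ((YoungDiagram.mem_cells _).mp hc)
    simp only [Finset.coe_range, Set.mem_Iio]
    omega

theorem sum_range_colLen {μ : YoungDiagram} {K : ℕ} (h : μ.colLen 0 ≤ K) (f : ℕ → ℤ) :
    ∑ i ∈ Finset.range (μ.colLen 0), (μ.rowLen i : ℤ) * f i =
      ∑ i ∈ Finset.range K, (μ.rowLen i : ℤ) * f i := by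
  refine Finset.sum_subset (Finset.range_mono h) fun i _ hi => ?_
  rw [rowLen_eq_zero (by simpa using hi)]; simp

theorem linearGrowth_qRho : LinearGrowth qRho := qShiftRho_bot ▸ linearGrowth_qShiftRho ⊥

/-- Padding with zero parts to a common length `K` allows the bounds for a triple to be added row by
row. -/
theorem hopfW_mem_ordGE {μ ν : YoungDiagram} {K : ℕ} (hμ : μ.colLen 0 ≤ K) (hν : ν.colLen 0 ≤ K) :
    hopfW μ ν ∈ ordGE (∑ i ∈ Finset.range K, ((μ.rowLen i : ℤ) * (2 * i + 1) +
      (ν.rowLen i : ℤ) * (2 * i + 1 - 2 * μ.rowLen i))) := by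
  rw [Finset.sum_add_distrib, ← sum_range_colLen hμ fun i => 2 * i + 1,
    ← sum_range_colLen hν fun i => 2 * i + 1 - 2 * μ.rowLen i]
  refine mul_mem_ordGE (schur_mem_ordGE linearGrowth_qRho (e := fun i => 2 * i + 1)
    (fun i j hij => by simp only; omega) (fun i => qHalfPow_mem_ordGE (by omega)) μ)
    (schur_mem_ordGE (linearGrowth_qShiftRho μ) (e := fun i => 2 * i + 1 - 2 * μ.rowLen i)
      (fun i j hij => ?_) (fun i => qHalfPow_mem_ordGE (by omega)) ν)
  have := μ.rowLen_anti i j hij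
  simp only; omega

/-- The coefficient of the summand of the partition function belonging to `m`, without its sign. -/
noncomputable def hopfTriple (m : YoungDiagram × YoungDiagram × YoungDiagram) : QSeries :=
  hopfW m.1 m.2.1 * hopfW m.2.1 m.2.2 * hopfW m.2.2 m.1 *
    qHalfPow (kappa m.1 + kappa m.2.1 + kappa m.2.2)

theorem normalized_coeffI (d : ℕ) :
    (-1) ^ d * qHalfPow (-((d : ℤ) ^ 2 - 3 * (d : ℤ))) * coeffI d =
      ∑ m ∈ (finite_triples d).toFinset, qHalfPow (-((d : ℤ) ^ 2 - 3 * (d : ℤ))) * hopfTriple m := by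
  have hcoeff : ∀ m, PowerSeries.coeff d (partitionTerm m) =
      if m.1.card + m.2.1.card + m.2.2.card = d then (-1) ^ d * hopfTriple m else 0 := fun m => by
    simp only [partitionTerm, neg_pow (PowerSeries.X : PowerSeries QSeries)]
    rw [PowerSeries.coeff_C_mul, ← map_one PowerSeries.C, ← map_neg, ← map_pow,
      PowerSeries.coeff_C_mul, PowerSeries.coeff_X_pow]
    by_cases h : m.1.card + m.2.1.card + m.2.2.card = d
    · simp only [h, hopfTriple, if_true]; ring
    · rw [if_neg fun e => h e.symm, if_neg h]; simp
  have hsum : coeffI d = ∑ m ∈ (finite_triples d).toFinset, (-1) ^ d * hopfTriple m := by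
    rw [coeffI, partitionZ, PowerSeries.coeff_mk, finsum_eq_sum_of_support_subset
      (s := (finite_triples d).toFinset)]
    · refine Finset.sum_congr rfl fun m hm => ?_
      rw [hcoeff, if_pos (by simpa using hm)]
    · intro m hm
      by_contra h
      exact hm ((hcoeff m).trans (if_neg (by simpa using h)))
  rw [hsum, Finset.mul_sum]
  refine Finset.sum_congr rfl fun m _ => ?_
  have : ((-1 : QSeries) ^ d) * (-1) ^ d = 1 := by
    rcases neg_one_pow_eq_or QSeries d with h | h <;> rw [h] <;> ring
  linear_combination (qHalfPow (-((d : ℤ) ^ 2 - 3 * (d : ℤ))) * hopfTriple m) * this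

/-- The triples whose first rows have total length at most `d - 2` do not contribute above
`q ^ (-2 d)`. -/
theorem hopfTriple_mem_ordGE {d : ℕ} {m : YoungDiagram × YoungDiagram × YoungDiagram}
    (hm : m.1.card + m.2.1.card + m.2.2.card = d)
    (hrow : m.1.rowLen 0 + m.2.1.rowLen 0 + m.2.2.rowLen 0 + 2 ≤ d) :
    qHalfPow (-((d : ℤ) ^ 2 - 3 * (d : ℤ))) * hopfTriple m ∈ ordGE (4 * d) := by
  obtain ⟨α, β, γ⟩ := m
  simp only at hm hrow
  set K := α.colLen 0 + β.colLen 0 + γ.colLen 0 with hK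
  have hα : α.colLen 0 ≤ K + 1 := by omega
  have hβ : β.colLen 0 ≤ K + 1 := by omega
  have hγ : γ.colLen 0 ≤ K + 1 := by omega
  have hmem := mul_mem_ordGE (qHalfPow_mem_ordGE
    (le_refl (- -((d : ℤ) ^ 2 - 3 * (d : ℤ))))) (mul_mem_ordGE (mul_mem_ordGE (mul_mem_ordGE
    (hopfW_mem_ordGE hα hβ) (hopfW_mem_ordGE hβ hγ)) (hopfW_mem_ordGE hγ hα))
    (qHalfPow_mem_ordGE (le_refl (-(kappa α + kappa β + kappa γ)))))
  refine ordGE_anti ?_ hmem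
  set l : ℕ → ℤ := fun i => α.rowLen i + β.rowLen i + γ.rowLen i with hl
  have hl0 : ∀ i, 0 ≤ l i := fun i => by simp only [hl]; positivity
  -- The mixed terms from the three Hopf link invariants and the squares from `kappa` combine to `-l
  -- i ^ 2`.
  have hE : (∑ i ∈ Finset.range (K + 1), ((α.rowLen i : ℤ) * (2 * i + 1) +
      (β.rowLen i : ℤ) * (2 * i + 1 - 2 * α.rowLen i))) +
      (∑ i ∈ Finset.range (K + 1), ((β.rowLen i : ℤ) * (2 * i + 1) +
      (γ.rowLen i : ℤ) * (2 * i + 1 - 2 * β.rowLen i))) +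
      (∑ i ∈ Finset.range (K + 1), ((γ.rowLen i : ℤ) * (2 * i + 1) +
      (α.rowLen i : ℤ) * (2 * i + 1 - 2 * γ.rowLen i))) + -(kappa α + kappa β + kappa γ) =
      ∑ i ∈ Finset.range (K + 1), ((6 * i + 3) * l i - l i ^ 2) := by
    rw [kappa, kappa, kappa, sum_range_colLen hα fun i => (α.rowLen i : ℤ) - 2 * ((i : ℤ) + 1) + 1,
      sum_range_colLen hβ fun i => (β.rowLen i : ℤ) - 2 * ((i : ℤ) + 1) + 1,
      sum_range_colLen hγ fun i => (γ.rowLen i : ℤ) - 2 * ((i : ℤ) + 1) + 1, neg_add, neg_add]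
    simp only [← Finset.sum_neg_distrib, ← Finset.sum_add_distrib]
    refine Finset.sum_congr rfl fun i _ => ?_
    simp only [hl]; ring
  have hd : (d : ℤ) = ∑ i ∈ Finset.range (K + 1), l i := by
    rw [← hm, card_eq_sum_rowLen hα, card_eq_sum_rowLen hβ, card_eq_sum_rowLen hγ]
    simp only [hl, Finset.sum_add_distrib]; push_cast; ring
  rw [hE]
  rw [Finset.sum_range_succ'] at hd ⊢
  set k := ∑ i ∈ Finset.range K, l (i + 1) with hk
  -- Below the first row the linear coefficient is at least 9, and `l (i + 1) ≤ k` bounds the sum of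
  -- squares by `k ^ 2`.
  have hrest : 9 * k - k ^ 2 ≤
      ∑ i ∈ Finset.range K, ((6 * ((i + 1 : ℕ) : ℤ) + 3) * l (i + 1) - l (i + 1) ^ 2) := by
    have h1 : 9 * k - k * k = ∑ i ∈ Finset.range K, (9 * l (i + 1) - k * l (i + 1)) := by
      rw [Finset.sum_sub_distrib, ← Finset.mul_sum, ← Finset.mul_sum]
    rw [sq, h1]
    refine Finset.sum_le_sum fun i hi => ?_
    have h2 : l (i + 1) ≤ k := Finset.single_le_sum (f := fun i => l (i + 1)) (fun j _ => hl0 _) hi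
    have h3 := hl0 (i + 1)
    push_cast
    nlinarith [mul_nonneg (Int.natCast_nonneg i) h3]
  have hk2 : 2 ≤ k := by
    have : l 0 + 2 ≤ d := by simp only [hl]; exact_mod_cast hrow
    omega
  have := hl0 0
  push_cast at hrest ⊢
  -- The bound `2 * l 0 * k + 6 * k` exceeds `4 * d = 4 * l 0 + 4 * k` by `2 * l 0 * (k - 2) + 2 *
  -- k`.
  nlinarith [mul_nonneg this (sub_nonneg.mpr hk2)]

/-! ### Reduction to rows and hooks. -/

/-- The partition `(a)`. -/
def rowDiagram (a : ℕ) : YoungDiagram where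
  cells := {0} ×ˢ Finset.range a
  isLowerSet := by
    rintro ⟨i, j⟩ ⟨k, l⟩ ⟨h1, h2⟩ h
    simp only [Finset.coe_product, Finset.coe_singleton, Finset.coe_range, Set.mem_prod,
      Set.mem_singleton_iff, Set.mem_Iio] at h h1 h2 ⊢
    omega

/-- The partition `(a + 1, 1)`. -/
def hookDiagram (a : ℕ) : YoungDiagram where
  cells := {0} ×ˢ Finset.range (a + 1) ∪ {(1, 0)}
  isLowerSet := by
    rintro ⟨i, j⟩ ⟨k, l⟩ ⟨h1, h2⟩ h
    simp only [Finset.coe_union, Finset.coe_product, Finset.coe_singleton, Finset.coe_range,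
      Set.mem_union, Set.mem_prod, Set.mem_singleton_iff, Set.mem_Iio, Prod.mk.injEq] at h h1 h2 ⊢
    omega

theorem rowLen_rowDiagram (a i : ℕ) : (rowDiagram a).rowLen i = if i = 0 then a else 0 := by
  refine eq_of_forall_lt_iff fun j => ?_
  rw [← YoungDiagram.mem_iff_lt_rowLen, ← YoungDiagram.mem_cells]
  simp only [rowDiagram, Finset.mem_product, Finset.mem_singleton, Finset.mem_range]
  split_ifs <;> omega

theorem rowLen_hookDiagram (a i : ℕ) :
    (hookDiagram a).rowLen i = if i = 0 then a + 1 else if i = 1 then 1 else 0 := by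
  refine eq_of_forall_lt_iff fun j => ?_
  rw [← YoungDiagram.mem_iff_lt_rowLen, ← YoungDiagram.mem_cells]
  simp only [hookDiagram, Finset.mem_union, Finset.mem_product, Finset.mem_singleton,
    Finset.mem_range, Prod.mk.injEq]
  split_ifs <;> omega

theorem card_rowDiagram (a : ℕ) : (rowDiagram a).card = a := by
  simp [YoungDiagram.card, rowDiagram]

theorem card_hookDiagram (a : ℕ) : (hookDiagram a).card = a + 2 := by
  rw [YoungDiagram.card, hookDiagram, Finset.card_union_of_disjoint]
  · simp
  · simp

theorem colLen_rowDiagram (a : ℕ) : (rowDiagram (a + 1)).colLen 0 = 1 := by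
  refine eq_of_forall_lt_iff fun i => ?_
  rw [lt_colLen_zero_iff, rowLen_rowDiagram]
  split_ifs <;> omega

theorem colLen_rowDiagram_zero : (rowDiagram 0).colLen 0 = 0 := by
  refine eq_of_forall_lt_iff fun i => ?_
  rw [lt_colLen_zero_iff, rowLen_rowDiagram]
  split_ifs <;> omega

theorem colLen_hookDiagram (a : ℕ) : (hookDiagram a).colLen 0 = 2 := by
  refine eq_of_forall_lt_iff fun i => ?_
  rw [lt_colLen_zero_iff, rowLen_hookDiagram]
  split_ifs <;> omega

theorem rowLen_zero_le_card (μ : YoungDiagram) : μ.rowLen 0 ≤ μ.card := by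
  rw [μ.rowLen_eq_card]; exact Finset.card_le_card (Finset.filter_subset _ _)

theorem eq_rowDiagram {μ : YoungDiagram} (h : μ.card = μ.rowLen 0) :
    μ = rowDiagram (μ.rowLen 0) := by
  rw [card_eq_sum_rowLen (Nat.le_succ _), Finset.sum_range_succ', Nat.add_eq_right,
    Finset.sum_eq_zero_iff] at h
  refine youngDiagram_ext fun i => ?_
  rw [rowLen_rowDiagram]
  split_ifs with hi
  · rw [hi]
  · by_cases hc : i - 1 < μ.colLen 0
    · rw [← h (i - 1) (Finset.mem_range.mpr hc)]; congr 1; omega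
    · exact rowLen_eq_zero (by omega)

theorem eq_hookDiagram {μ : YoungDiagram} (h : μ.card = μ.rowLen 0 + 1) :
    μ = hookDiagram (μ.rowLen 0 - 1) := by
  rw [card_eq_sum_rowLen (K := μ.colLen 0 + 2) (by omega), Finset.sum_range_succ',
    Finset.sum_range_succ', zero_add] at h
  have h01 := μ.rowLen_anti 0 1 zero_le_one
  have h1 : μ.rowLen 1 ≠ 0 := fun h0 => by
    have : ∑ k ∈ Finset.range (μ.colLen 0), μ.rowLen (k + 1 + 1) = 0 :=
      Finset.sum_eq_zero fun k _ =>
        Nat.le_zero.mp (h0 ▸ μ.rowLen_anti 1 (k + 1 + 1) (by omega))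
    omega
  have h2 : ∑ k ∈ Finset.range (μ.colLen 0), μ.rowLen (k + 1 + 1) = 0 := by omega
  rw [Finset.sum_eq_zero_iff] at h2
  refine youngDiagram_ext fun i => ?_
  rw [rowLen_hookDiagram]
  split_ifs with hi hi'
  · rw [hi]; omega
  · rw [hi']; omega
  · by_cases hc : i - 2 < μ.colLen 0
    · rw [← h2 (i - 2) (Finset.mem_range.mpr hc)]; congr 1; omega
    · exact rowLen_eq_zero (by omega)

/-- The triples `(a, b, c)` of natural numbers with `a + b + c + n = d`. -/
def triples (n d : ℕ) : Finset (ℕ × ℕ × ℕ) :=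
  (Finset.range (d + 1) ×ˢ Finset.range (d + 1) ×ˢ Finset.range (d + 1)).filter
    fun p => p.1 + p.2.1 + p.2.2 + n = d

theorem mem_triples {n d : ℕ} {p : ℕ × ℕ × ℕ} :
    p ∈ triples n d ↔ p.1 + p.2.1 + p.2.2 + n = d := by
  simp only [triples, Finset.mem_filter, Finset.mem_product, Finset.mem_range]
  omega

theorem hopfTriple_rotate (α β γ : YoungDiagram) :
    hopfTriple (γ, α, β) = hopfTriple (α, β, γ) := by
  simp only [hopfTriple]
  rw [show kappa γ + kappa α + kappa β = kappa α + kappa β + kappa γ by ring]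
  ring

-- With at most one box below the first rows, either all three partitions are rows or exactly one is
-- `(a + 1, 1)`. The three positions of the hook contribute equally by cyclic symmetry, hence the
-- factor 3.
open Classical in
theorem sum_hopfTriple_sub_mem_ordGE (d : ℕ) :
    ∑ m ∈ (finite_triples d).toFinset, qHalfPow (-((d : ℤ) ^ 2 - 3 * (d : ℤ))) * hopfTriple m -
      (∑ p ∈ triples 0 d, qHalfPow (-((d : ℤ) ^ 2 - 3 * (d : ℤ))) *
          hopfTriple (rowDiagram p.1, rowDiagram p.2.1, rowDiagram p.2.2) +
        3 * ∑ p ∈ triples 2 d, qHalfPow (-((d : ℤ) ^ 2 - 3 * (d : ℤ))) *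
          hopfTriple (hookDiagram p.1, rowDiagram p.2.1, rowDiagram p.2.2)) ∈ ordGE (4 * d) := by
  set g : YoungDiagram × YoungDiagram × YoungDiagram → QSeries :=
    fun m => qHalfPow (-((d : ℤ) ^ 2 - 3 * (d : ℤ))) * hopfTriple m with hg
  set T := (finite_triples d).toFinset with hT
  have memT : ∀ m, m ∈ T ↔ m.1.card + m.2.1.card + m.2.2.card = d := fun m => by simp [hT]
  let R : YoungDiagram → Prop := fun μ => μ.card = μ.rowLen 0
  let S : YoungDiagram → Prop := fun μ => μ.card = μ.rowLen 0 + 1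
  have hRS : ∀ μ, R μ → ¬ S μ := fun μ h1 h2 => by simp only [R, S] at h1 h2; omega
  have hSR : ∀ μ, S μ → ¬ R μ := fun μ h1 h2 => hRS μ h2 h1
  have hR : ∀ a, R (rowDiagram a) := fun a => by
    simp only [R]; rw [card_rowDiagram, rowLen_rowDiagram]; simp
  have hS : ∀ a, S (hookDiagram a) := fun a => by
    simp only [S]; rw [card_hookDiagram, rowLen_hookDiagram]; simp
  have r0 : ∀ a, (rowDiagram a).rowLen 0 = a := fun a => by rw [rowLen_rowDiagram]; simp
  have k0 : ∀ a, (hookDiagram a).rowLen 0 = a + 1 := fun a => by rw [rowLen_hookDiagram]; simp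
  have hSpos : ∀ μ, S μ → 1 ≤ μ.rowLen 0 := fun μ h => by
    have h1 : μ.rowLen 0 = (hookDiagram (μ.rowLen 0 - 1)).rowLen 0 :=
      congrArg (fun ν => YoungDiagram.rowLen ν 0) (eq_hookDiagram h)
    rw [k0] at h1; omega
  have e0 : ∑ p ∈ triples 0 d, g (rowDiagram p.1, rowDiagram p.2.1, rowDiagram p.2.2) =
      ∑ m ∈ T, if R m.1 ∧ R m.2.1 ∧ R m.2.2 then g m else 0 := by
    rw [← Finset.sum_filter]
    refine Finset.sum_nbij' (fun p => (rowDiagram p.1, rowDiagram p.2.1, rowDiagram p.2.2))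
      (fun m => (m.1.rowLen 0, m.2.1.rowLen 0, m.2.2.rowLen 0)) ?_ ?_ ?_ ?_ ?_
    · intro p hp
      rw [mem_triples] at hp
      simp [memT, card_rowDiagram, hR]; omega
    · rintro m hm
      rw [Finset.mem_filter, memT] at hm
      simp only [R] at hm
      rw [mem_triples]; simp only; omega
    · intro p _; simp [r0]
    · rintro ⟨α, β, γ⟩ hm
      obtain ⟨-, h1, h2, h3⟩ := Finset.mem_filter.mp hm
      simp only
      rw [← eq_rowDiagram h1, ← eq_rowDiagram h2, ← eq_rowDiagram h3]
    · intro p _; rfl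
  have e1 : ∑ p ∈ triples 2 d, g (hookDiagram p.1, rowDiagram p.2.1, rowDiagram p.2.2) =
      ∑ m ∈ T, if S m.1 ∧ R m.2.1 ∧ R m.2.2 then g m else 0 := by
    rw [← Finset.sum_filter]
    refine Finset.sum_nbij' (fun p => (hookDiagram p.1, rowDiagram p.2.1, rowDiagram p.2.2))
      (fun m => (m.1.rowLen 0 - 1, m.2.1.rowLen 0, m.2.2.rowLen 0)) ?_ ?_ ?_ ?_ ?_
    · intro p hp
      rw [mem_triples] at hp
      simp [memT, card_rowDiagram, card_hookDiagram, hR, hS]; omega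
    · rintro m hm
      rw [Finset.mem_filter, memT] at hm
      have := hSpos _ hm.2.1
      simp only [R, S] at hm
      rw [mem_triples]; simp only; omega
    · intro p _; simp [r0, k0]
    · rintro ⟨α, β, γ⟩ hm
      obtain ⟨-, h1, h2, h3⟩ := Finset.mem_filter.mp hm
      simp only
      rw [← eq_hookDiagram h1, ← eq_rowDiagram h2, ← eq_rowDiagram h3]
    · intro p _; rfl
  have hrot : ∀ P : YoungDiagram → YoungDiagram → YoungDiagram → Prop,
      [∀ α β γ, Decidable (P α β γ)] → ∑ m ∈ T, (if P m.1 m.2.1 m.2.2 then g m else 0) =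
        ∑ m ∈ T, if P m.2.1 m.2.2 m.1 then g m else 0 := fun P _ => by
    refine Finset.sum_nbij' (fun m => (m.2.2, m.1, m.2.1)) (fun m => (m.2.1, m.2.2, m.1))
      ?_ ?_ ?_ ?_ ?_
    · intro m hm; rw [memT] at hm ⊢; simp only; omega
    · intro m hm; rw [memT] at hm ⊢; simp only; omega
    · intro m _; rfl
    · intro m _; rfl
    · rintro ⟨α, β, γ⟩ _; simp only [hg, hopfTriple_rotate α β γ]
  have e2 := e1.trans (hrot fun α β γ => S α ∧ R β ∧ R γ)
  have e3 := e2.trans (hrot fun α β γ => S β ∧ R γ ∧ R α)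
  have e4 : 3 * ∑ p ∈ triples 2 d, g (hookDiagram p.1, rowDiagram p.2.1, rowDiagram p.2.2) =
      (∑ m ∈ T, if S m.1 ∧ R m.2.1 ∧ R m.2.2 then g m else 0) +
      (∑ m ∈ T, if S m.2.1 ∧ R m.2.2 ∧ R m.1 then g m else 0) +
      ∑ m ∈ T, if S m.2.2 ∧ R m.1 ∧ R m.2.1 then g m else 0 := by
    linear_combination e1 + e2 + e3
  change ∑ m ∈ T, g m - (∑ p ∈ triples 0 d, g (rowDiagram p.1, rowDiagram p.2.1, rowDiagram p.2.2) +
    3 * ∑ p ∈ triples 2 d, g (hookDiagram p.1, rowDiagram p.2.1, rowDiagram p.2.2)) ∈ _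
  rw [e4, e0]
  rw [← Finset.sum_add_distrib, ← Finset.sum_add_distrib, ← Finset.sum_add_distrib,
    ← Finset.sum_sub_distrib]
  refine sum_mem fun m hm => ?_
  rw [memT] at hm
  have h1 := rowLen_zero_le_card m.1
  have h2 := rowLen_zero_le_card m.2.1
  have h3 := rowLen_zero_le_card m.2.2
  -- With two or more boxes below the first rows `g m` itself is negligible. Otherwise exactly one
  -- of the four indicators holds and the difference vanishes.
  by_cases hlt : m.1.rowLen 0 + m.2.1.rowLen 0 + m.2.2.rowLen 0 + 2 ≤ d
  · have hmem := hopfTriple_mem_ordGE hm hlt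
    refine sub_mem hmem (add_mem ?_ (add_mem (add_mem ?_ ?_) ?_)) <;> split_ifs <;>
      first | exact hmem | exact zero_mem _
  · have : (R m.1 ∧ R m.2.1 ∧ R m.2.2) ∨ (S m.1 ∧ R m.2.1 ∧ R m.2.2) ∨
      (S m.2.1 ∧ R m.2.2 ∧ R m.1) ∨ (S m.2.2 ∧ R m.1 ∧ R m.2.1) := by
      simp only [R, S]; omega
    convert (ordGE (4 * d)).zero_mem using 1
    rcases this with h | h | h | h
    · simp [h, hRS _ h.1, hRS _ h.2.1, hRS _ h.2.2]
    · simp [h, hRS _ h.2.1, hRS _ h.2.2, hSR _ h.1]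
    · simp [h, hRS _ h.2.1, hRS _ h.2.2, hSR _ h.1]
    · simp [h, hRS _ h.2.1, hRS _ h.2.2, hSR _ h.1]

/-! ### Explicit Hopf link invariants of rows and hooks. -/

/-- `∑_{j ≤ b} x^{(a + 1) j} / (x; x)_j`. -/
noncomputable def rowSum (a b : ℕ) : QSeries :=
  ∑ j ∈ Finset.range (b + 1), qInv ^ ((a + 1) * j) / qFact j

theorem rowSum_zero (a : ℕ) : rowSum a 0 = 1 := by simp [rowSum]

theorem rowSum_succ (a b : ℕ) :
    rowSum a (b + 1) = rowSum a b + qInv ^ ((a + 1) * (b + 1)) / qFact (b + 1) :=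
  Finset.sum_range_succ _ _

/-- The Hopf link invariant of two one-row partitions, divided by its leading monomial. -/
noncomputable def rowRow (a b : ℕ) : QSeries := rowSum a b / qFact a

theorem rowRow_succ_right (a b : ℕ) : rowRow a (b + 1) =
    rowRow a b + qInv ^ ((a + 1) * (b + 1)) / (qFact a * qFact (b + 1)) := by
  have := qFact_ne_zero a
  have := qFact_ne_zero (b + 1)
  rw [rowRow, rowRow, rowSum_succ]; field_simp

/-- The mirror image of `rowRow_succ_right`. The two recursions give the symmetry `rowRow_comm`,
which the defining sum does not show. -/
theorem rowRow_succ_left (a b : ℕ) : rowRow (a + 1) b =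
    rowRow a b + qInv ^ ((a + 1) * (b + 1)) / (qFact (a + 1) * qFact b) := by
  have h1 := qFact_ne_zero a
  have h2 := qFact_ne_zero b
  have h3 := one_sub_qInv_pow_ne_zero a
  have h4 := one_sub_qInv_pow_ne_zero b
  induction b with
  | zero =>
    simp only [rowRow, rowSum_zero, qFact_succ, qFact_zero]; field_simp; ring
  | succ b ih =>
    have h5 := qFact_ne_zero b
    have h6 := one_sub_qInv_pow_ne_zero b
    rw [rowRow_succ_right, rowRow_succ_right, ih h5 h6]
    simp only [qFact_succ]
    field_simp
    ring

theorem rowRow_zero_right (a : ℕ) : rowRow a 0 = 1 / qFact a := by rw [rowRow, rowSum_zero]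

theorem rowRow_zero_left (b : ℕ) : rowRow 0 b = 1 / qFact b := by
  induction b with
  | zero => rw [rowRow_zero_right]
  | succ b ih =>
    have := qFact_ne_zero b
    have := one_sub_qInv_pow_ne_zero b
    rw [rowRow_succ_right, ih, qFact_succ]; simp only [qFact_zero]; field_simp; ring

theorem rowRow_comm (a b : ℕ) : rowRow a b = rowRow b a := by
  induction a with
  | zero => rw [rowRow_zero_left, rowRow_zero_right]
  | succ a ih => rw [rowRow_succ_left, rowRow_succ_right, ih]; ring_nf

/-- Dropping the first variable of a geometric sequence multiplies it by x, so the recursion becomes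
(1 - x^(k+1)) h_(k+1) = y_0 h_k. -/
theorem hsymm_qRho_shift (m k : ℕ) :
    hsymm (fun i => qRho (i + m)) k = qHalfPow (-((2 * m + 1) * k)) / qFact k := by
  induction k with
  | zero => simp [hsymm_zero, qHalfPow_zero]
  | succ k ih =>
    have h1 := hsymm_succ (linearGrowth_qRho.shift_add m) k
    have h2 : (fun i => qRho (i + 1 + m)) = fun i => qInv * qRho (i + m) := by
      funext i
      rw [qRho, qRho, qInv, qHalfPow_mul]; congr 1; push_cast; ring
    rw [h2, hsymm_smul, ih] at h1
    have h3 : qHalfPow (-((2 * m + 1) * (k + 1 : ℕ))) =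
        qRho (0 + m) * qHalfPow (-((2 * m + 1) * k)) := by
      rw [qRho, qHalfPow_mul]; congr 1; push_cast; ring
    have h4 := qFact_ne_zero k
    have h5 := one_sub_qInv_pow_ne_zero k
    rw [h3, qFact_succ]
    field_simp at h1 ⊢
    linear_combination h1

theorem hsymm_qRho (k : ℕ) : hsymm qRho k = qHalfPow (-k) / qFact k := by
  simpa using hsymm_qRho_shift 0 k

theorem schur_rowDiagram (a : ℕ) (y : ℕ → QSeries) : schur (rowDiagram a) y = hsymm y a := by
  have key : ∀ n, (rowDiagram a).colLen 0 = n → schur (rowDiagram a) y =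
      (Matrix.of fun i j : Fin n =>
        hsymmInt y (((rowDiagram a).rowLen i : ℤ) - (i : ℤ) + (j : ℤ))).det := by
    rintro _ rfl; rfl
  cases a with
  | zero => rw [key 0 colLen_rowDiagram_zero, hsymm_zero]; simp
  | succ a =>
    rw [key 1 (colLen_rowDiagram a), Matrix.det_fin_one, ← hsymmInt_natCast]
    simp [rowLen_rowDiagram]

theorem schur_hookDiagram (a : ℕ) (y : ℕ → QSeries) :
    schur (hookDiagram a) y = hsymm y (a + 1) * hsymm y 1 - hsymm y (a + 2) := by
  have key : ∀ n, (hookDiagram a).colLen 0 = n → schur (hookDiagram a) y =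
      (Matrix.of fun i j : Fin n =>
        hsymmInt y (((hookDiagram a).rowLen i : ℤ) - (i : ℤ) + (j : ℤ))).det := by
    rintro _ rfl; rfl
  rw [key 2 (colLen_hookDiagram a), Matrix.det_fin_two, ← hsymmInt_natCast, ← hsymmInt_natCast,
    ← hsymmInt_natCast]
  have h0 : hsymmInt y 0 = 1 := by rw [← hsymm_zero y, ← hsymmInt_natCast]; rfl
  simp [rowLen_hookDiagram, h0, add_assoc]

/-- Only the first variable depends on `a`. Splitting it off leaves a tail of q^ϱ, whose h_(b+1) is
the new term of `rowSum`. -/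
theorem hsymm_qShiftRho_rowDiagram (a b : ℕ) :
    hsymm (qShiftRho (rowDiagram a)) b = qHalfPow ((2 * a - 1) * b) * rowSum a b := by
  induction b with
  | zero => simp [hsymm_zero, rowSum_zero, qHalfPow_zero]
  | succ b ih =>
    have h2 : (fun i => qShiftRho (rowDiagram a) (i + 1)) = fun i => qRho (i + 1) := by
      funext i
      rw [qShiftRho, qRho, rowLen_rowDiagram]; simp
    have h0 : qShiftRho (rowDiagram a) 0 * qHalfPow ((2 * a - 1) * b) =
        qHalfPow ((2 * a - 1) * (b + 1 : ℕ)) := by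
      rw [qShiftRho, rowLen_rowDiagram, if_pos rfl, qHalfPow_mul]; congr 1; push_cast; ring
    have h1 : qHalfPow (-((2 * (1 : ℕ) + 1) * (b + 1 : ℕ))) =
        qHalfPow ((2 * a - 1) * (b + 1 : ℕ)) * qInv ^ ((a + 1) * (b + 1)) := by
      rw [qInv_pow, qHalfPow_mul]; congr 1; push_cast; ring
    rw [hsymm_succ (linearGrowth_qShiftRho _), h2, hsymm_qRho_shift, ih, rowSum_succ, h1,
      ← mul_assoc, h0]
    ring

theorem hopfW_row_row (a b : ℕ) :
    hopfW (rowDiagram a) (rowDiagram b) = qHalfPow (2 * a * b - a - b) * rowRow a b := by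
  rw [hopfW, schur_rowDiagram, schur_rowDiagram, hsymm_qRho, hsymm_qShiftRho_rowDiagram, rowRow,
    show (2 * a * b - a - b : ℤ) = -a + (2 * a - 1) * b by ring, ← qHalfPow_mul]
  ring

/-- The Hopf link invariant of the partitions `(a + 1, 1)` and `(b)`, divided by its leading
monomial. -/
noncomputable def hookRow (a b : ℕ) : QSeries :=
  rowRow (a + 1) b / (1 - qInv) - qInv ^ ((b + 1) * (a + 1)) / (qFact b * qFact (a + 2))

theorem hopfW_row_hook (a b : ℕ) : hopfW (rowDiagram b) (hookDiagram a) =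
    qHalfPow (2 * (a + 1) * b - b - (a + 1) - 3) * hookRow a b := by
  have h1 := qFact_ne_zero b
  have h2 := qFact_ne_zero (a + 2)
  have h3 := one_sub_qInv_ne_zero
  have hexp : qHalfPow (2 * (a + 1) * b - b - (a + 1) - 3) = qHalfPow (-b) *
      qHalfPow ((2 * b - 1) * (a + 1 : ℕ)) * qHalfPow ((2 * b - 1) * (1 : ℕ)) * qInv ^ (b + 1) := by
    simp only [qInv_pow, qHalfPow_mul]; congr 1; push_cast; ring
  have hexp2 : qHalfPow ((2 * b - 1) * (a + 2 : ℕ)) =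
      qHalfPow ((2 * b - 1) * (a + 1 : ℕ)) * qHalfPow ((2 * b - 1) * (1 : ℕ)) := by
    simp only [qHalfPow_mul]; congr 1; push_cast; ring
  have hS : rowSum b 1 = 1 + qInv ^ (b + 1) / (1 - qInv) := by
    rw [show (1 : ℕ) = 0 + 1 from rfl, rowSum_succ, rowSum_zero]; simp [qFact_one]
  rw [hopfW, schur_rowDiagram, schur_hookDiagram, hsymm_qRho]
  simp only [hsymm_qShiftRho_rowDiagram]
  rw [hexp2, hookRow, rowRow_comm, rowRow, hS, rowSum_succ b (a + 1)]
  have hx : qInv ^ ((b + 1) * (a + 1 + 1)) = qInv ^ (b + 1) * qInv ^ ((b + 1) * (a + 1)) := by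
    rw [← pow_add]; congr 1; ring
  rw [hx]
  generalize qHalfPow (2 * (a + 1) * b - b - (a + 1) - 3) = A at *
  generalize qHalfPow ((2 * b - 1) * (a + 1 : ℕ)) = B at *
  generalize qHalfPow ((2 * b - 1) * (1 : ℕ)) = C at *
  generalize qHalfPow (-b) = D at *
  have e : D / qFact b * (B * rowSum b (a + 1) * (C * (1 + qInv ^ (b + 1) / (1 - qInv))) -
      B * C * (rowSum b (a + 1) + qInv ^ (b + 1) * qInv ^ ((b + 1) * (a + 1)) / qFact (a + 1 + 1))) =
      (D * B * C) / qFact b * (rowSum b (a + 1) * qInv ^ (b + 1) / (1 - qInv) -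
        qInv ^ (b + 1) * qInv ^ ((b + 1) * (a + 1)) / qFact (a + 1 + 1)) := by
    ring
  rw [e, hexp]
  field_simp

/-- The factor 1 - x^(a+1) stays on the left because it also occurs in s_(a+1,1)(q^ϱ);
`hopfW_hook_row` needs exactly this product. -/
theorem hsymm_qShiftRho_hookDiagram (a b : ℕ) :
    (1 - qInv ^ (a + 1)) * hsymm (qShiftRho (hookDiagram a)) b = qHalfPow ((2 * a + 1) * b) *
      ((1 - qInv ^ (a + 2)) * rowSum (a + 1) b -
        (1 - qInv) * qInv ^ ((b + 1) * (a + 1)) / qFact b) := by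
  -- The variables after the first: the second is shifted by the single box of row two, and the rest
  -- form a tail of q^ϱ.
  have hc : ∀ k : ℕ, hsymm (fun i => qShiftRho (hookDiagram a) (i + 1)) k =
      qHalfPow (-k) * (1 - qInv + qInv ^ (k + 1)) / qFact k := fun k => by
    induction k with
    | zero => simp [hsymm_zero, qHalfPow_zero]
    | succ k ih =>
      have h2 : (fun i => qShiftRho (hookDiagram a) (i + 1 + 1)) = fun i => qRho (i + 2) := by
        funext i
        rw [qShiftRho, qRho, rowLen_hookDiagram, if_neg (by omega), if_neg (by omega)]
        congr 1
      have h3 : qShiftRho (hookDiagram a) (0 + 1) * qHalfPow (-k) = qHalfPow (-(k + 1 : ℕ)) := by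
        rw [qShiftRho, rowLen_hookDiagram, if_neg (by omega), if_pos rfl, qHalfPow_mul]
        congr 1; push_cast; ring
      have h4 : qHalfPow (-((2 * (2 : ℕ) + 1) * (k + 1 : ℕ))) =
          qHalfPow (-(k + 1 : ℕ)) * qInv ^ (k + 1) * qInv ^ (k + 1) := by
        simp only [qInv_pow, qHalfPow_mul]; congr 1; push_cast; ring
      have h5 := qFact_ne_zero k
      have h6 := one_sub_qInv_pow_ne_zero k
      rw [hsymm_succ (linearGrowth_qShiftRho _).shift, h2, hsymm_qRho_shift, ih, h4,
        mul_div_assoc (qHalfPow (-k)), ← mul_assoc (qShiftRho _ _), h3, qFact_succ]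
      field_simp
      ring
  induction b with
  | zero => simp [hsymm_zero, rowSum_zero, qHalfPow_zero]; ring
  | succ b ih =>
    have h0 : qShiftRho (hookDiagram a) 0 * qHalfPow ((2 * a + 1) * b) =
        qHalfPow ((2 * a + 1) * (b + 1 : ℕ)) := by
      rw [qShiftRho, rowLen_hookDiagram, if_pos rfl, qHalfPow_mul]; congr 1; push_cast; ring
    have h4 : qHalfPow (-(b + 1 : ℕ)) =
        qHalfPow ((2 * a + 1) * (b + 1 : ℕ)) * qInv ^ ((b + 1) * (a + 1)) := by
      simp only [qInv_pow, qHalfPow_mul]; congr 1; push_cast; ring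
    have h5 := qFact_ne_zero b
    have h6 := one_sub_qInv_pow_ne_zero b
    rw [hsymm_succ (linearGrowth_qShiftRho _), hc, h4, mul_add, ← mul_assoc _ (qShiftRho _ 0),
      mul_comm _ (qShiftRho _ 0), mul_assoc (qShiftRho _ 0), ih, ← mul_assoc, h0, rowSum_succ,
      qFact_succ]
    have e1 : qInv ^ ((a + 1 + 1) * (b + 1)) = qInv ^ ((b + 1) * (a + 1)) * qInv ^ (b + 1) := by
      rw [← pow_add]; congr 1; ring
    have e2 : qInv ^ ((b + 1 + 1) * (a + 1)) = qInv ^ ((b + 1) * (a + 1)) * qInv ^ (a + 1) := by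
      rw [← pow_add]; congr 1; ring
    rw [e1, e2, pow_succ qInv (b + 1), pow_succ qInv (a + 1)]
    field_simp
    ring

/-- The same value as `hopfW_row_hook`. Both are needed, since a cyclic product has the hook once in
each slot of the Hopf link invariant. -/
theorem hopfW_hook_row (a b : ℕ) : hopfW (hookDiagram a) (rowDiagram b) =
    qHalfPow (2 * (a + 1) * b - b - (a + 1) - 3) * hookRow a b := by
  have h1 := qFact_ne_zero b
  have h2 := qFact_ne_zero (a + 1)
  have h3 := one_sub_qInv_ne_zero
  have h4 := one_sub_qInv_pow_ne_zero (a + 1)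
  have hh := hsymm_qShiftRho_hookDiagram a b
  have hexp : qHalfPow (2 * (a + 1) * b - b - (a + 1) - 3) =
      qHalfPow (-(a + 1 : ℕ)) * qHalfPow (-(1 : ℕ)) * qInv * qHalfPow ((2 * a + 1) * b) := by
    simp only [qInv, qHalfPow_mul]; congr 1; push_cast; ring
  have hexp2 : qHalfPow (-(a + 2 : ℕ)) = qHalfPow (-(a + 1 : ℕ)) * qHalfPow (-(1 : ℕ)) := by
    simp only [qHalfPow_mul]; congr 1
  rw [hopfW, schur_rowDiagram, schur_hookDiagram, hsymm_qRho, hsymm_qRho, hsymm_qRho, hexp, hexp2,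
    hookRow, rowRow, qFact_one, qFact_succ (a + 1)]
  generalize qHalfPow (-(a + 1 : ℕ)) = A at *
  generalize qHalfPow (-(1 : ℕ)) = B at *
  generalize hsymm (qShiftRho (hookDiagram a)) b = h at *
  generalize qHalfPow ((2 * a + 1) * b) = C at *
  -- The numerator is (1 - x^(a+2)) - (1 - x) = x (1 - x^(a+1)).
  have e : (A / qFact (a + 1) * (B / (1 - qInv)) - A * B / (qFact (a + 1) * (1 - qInv ^ (a + 1 + 1)))) * h
      = A * B * qInv / (qFact (a + 1) * (1 - qInv) * (1 - qInv ^ (a + 1 + 1))) *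
        ((1 - qInv ^ (a + 1)) * h) := by
    field_simp
    ring
  rw [e, hh]
  field_simp

theorem kappa_rowDiagram (a : ℕ) : kappa (rowDiagram a) = a * (a - 1) := by
  have h : (rowDiagram a).colLen 0 ≤ 1 := by
    cases a with
    | zero => rw [colLen_rowDiagram_zero]; omega
    | succ a => rw [colLen_rowDiagram]
  rw [kappa, sum_range_colLen h fun i => ((rowDiagram a).rowLen i : ℤ) - 2 * ((i : ℤ) + 1) + 1]
  rw [Finset.sum_range_one, rowLen_rowDiagram, if_pos rfl]; push_cast; ring

theorem kappa_hookDiagram (a : ℕ) : kappa (hookDiagram a) = (a + 1) * a - 2 := by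
  rw [kappa, colLen_hookDiagram]
  simp [Finset.sum_range_succ, rowLen_hookDiagram]; ring

theorem hopfTriple_row {d : ℕ} {p : ℕ × ℕ × ℕ} (hp : p ∈ triples 0 d) :
    qHalfPow (-((d : ℤ) ^ 2 - 3 * (d : ℤ))) *
        hopfTriple (rowDiagram p.1, rowDiagram p.2.1, rowDiagram p.2.2) =
      rowRow p.1 p.2.1 * rowRow p.2.1 p.2.2 * rowRow p.2.2 p.1 := by
  obtain ⟨a, b, c⟩ := p
  rw [mem_triples] at hp
  simp only [hopfTriple, hopfW_row_row, kappa_rowDiagram]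
  have : qHalfPow (-((d : ℤ) ^ 2 - 3 * (d : ℤ))) * qHalfPow (2 * a * b - a - b) *
      qHalfPow (2 * b * c - b - c) * qHalfPow (2 * c * a - c - a) *
      qHalfPow (a * (a - 1) + b * (b - 1) + c * (c - 1)) = 1 := by
    simp only [qHalfPow_mul]
    rw [← qHalfPow_zero]; congr 1
    rw [← hp]; push_cast; ring
  linear_combination (rowRow a b * rowRow b c * rowRow c a) * this

theorem hopfTriple_hook {d : ℕ} {p : ℕ × ℕ × ℕ} (hp : p ∈ triples 2 d) :
    qHalfPow (-((d : ℤ) ^ 2 - 3 * (d : ℤ))) *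
        hopfTriple (hookDiagram p.1, rowDiagram p.2.1, rowDiagram p.2.2) =
      qInv ^ (d + 2) * (hookRow p.1 p.2.1 * rowRow p.2.1 p.2.2 * hookRow p.1 p.2.2) := by
  obtain ⟨a, b, c⟩ := p
  rw [mem_triples] at hp
  simp only [hopfTriple, hopfW_row_row, hopfW_hook_row, hopfW_row_hook, kappa_rowDiagram,
    kappa_hookDiagram]
  have : qHalfPow (-((d : ℤ) ^ 2 - 3 * (d : ℤ))) * qHalfPow (2 * (a + 1) * b - b - (a + 1) - 3) *
      qHalfPow (2 * b * c - b - c) * qHalfPow (2 * (a + 1) * c - c - (a + 1) - 3) *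
      qHalfPow ((a + 1) * a - 2 + b * (b - 1) + c * (c - 1)) = qInv ^ (d + 2) := by
    simp only [qInv_pow, qHalfPow_mul]
    congr 1
    rw [← hp]; push_cast; ring
  linear_combination (hookRow a b * rowRow b c * hookRow a c) * this

/-! ### Deviations from the limits and their sums. -/

theorem eq_zero_of_forall_mem_ordGE {f : QSeries} (h : ∀ N : ℕ, f ∈ ordGE N) : f = 0 := by
  ext n
  exact h (n + 1).toNat n (by omega)

/-- Since `S` tends to 0, `S m` is the sum of the `r a` with `a ≥ m`. -/
theorem mem_ordGE_of_telescope {S r : ℕ → QSeries} {N : ℤ} (hS : ∀ a : ℕ, S a ∈ ordGE a)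
    (h : ∀ a, S (a + 1) = S a - r a) (m : ℕ) (hr : ∀ a, m ≤ a → r a ∈ ordGE N) :
    S m ∈ ordGE N := by
  have key : ∀ n, S m - S (m + n) ∈ ordGE N := fun n => by
    induction n with
    | zero => simp
    | succ n ih =>
      rw [← add_assoc, h, ← sub_add]
      exact add_mem ih (hr _ (Nat.le_add_right m n))
  have := add_mem (key N.toNat) (ordGE_anti (by push_cast; omega) (hS (m + N.toNat)))
  rwa [sub_add_cancel] at this

/-- The difference is constant and tends to 0. -/
theorem eq_of_telescope {S U r : ℕ → QSeries} (hS : ∀ a : ℕ, S a ∈ ordGE a)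
    (hU : ∀ a : ℕ, U a ∈ ordGE a) (h : ∀ a, S (a + 1) = S a - r a)
    (h' : ∀ a, U (a + 1) = U a - r a) : S = U := by
  funext m
  rw [← sub_eq_zero]
  refine eq_zero_of_forall_mem_ordGE fun N => ?_
  exact mem_ordGE_of_telescope (S := fun a => S a - U a) (r := fun _ => 0)
    (fun a => sub_mem (hS a) (hU a)) (fun a => by simp only [h, h']; ring) m fun _ _ => zero_mem _

theorem qFact_sub_qInfFactorial_mem_ordGE (b : ℕ) :
    qFact b - qInfFactorial ∈ ordGE (2 * (b + 1)) := by
  have key : ∀ n, qFact b - qFact (b + n) ∈ ordGE (2 * (b + 1)) := fun n => by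
    induction n with
    | zero => simp
    | succ n ih =>
      have : qFact b - qFact (b + (n + 1)) =
          qFact b - qFact (b + n) + qFact (b + n) * qInv ^ (b + n + 1) := by
        rw [← add_assoc, qFact_succ]; ring
      rw [this]
      exact add_mem ih (mul_mem_ordGE_left (qFact_mem_ordGE _)
        (qInv_pow_mem_ordGE (by push_cast; omega)))
  refine (isClosed_ordGE _).mem_of_tendsto (b := atTop) (f := fun n => qFact b - qFact (b + n))
    (tendsto_const_nhds.sub ?_) (Eventually.of_forall key)
  simp_rw [add_comm b]
  exact (tendsto_add_atTop_iff_nat b).mpr tendsto_qFact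

theorem valuation_qInfFactorial : Valued.v qInfFactorial = 1 := by
  have h := qFact_sub_qInfFactorial_mem_ordGE 0
  rw [mem_ordGE_iff_valuation, qFact_zero] at h
  have h2 := Valuation.map_one_sub_of_lt (v := (Valued.v : Valuation QSeries _))
    (h.trans_lt (by rw [← WithZero.exp_zero, WithZero.exp_lt_exp]; simp))
  rwa [sub_sub_cancel] at h2

theorem qInfFactorial_ne_zero : qInfFactorial ≠ 0 := fun h => by
  have := valuation_qInfFactorial
  simp [h] at this

theorem inv_qInfFactorial_mem_ordGE : qInfFactorial⁻¹ ∈ ordGE 0 := by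
  rw [mem_ordGE_iff_valuation, map_inv₀, valuation_qInfFactorial]; simp

/-- The relative error of replacing `rowRow a b` by its limit `1 / [∞]!`. -/
noncomputable def rowDefect (a b : ℕ) : QSeries := 1 - qInfFactorial * rowRow a b

theorem rowDefect_comm (a b : ℕ) : rowDefect a b = rowDefect b a := by
  rw [rowDefect, rowDefect, rowRow_comm]

theorem rowDefect_succ_left (a b : ℕ) : rowDefect (a + 1) b = rowDefect a b -
    qInfFactorial * qInv ^ ((a + 1) * (b + 1)) / (qFact (a + 1) * qFact b) := by
  rw [rowDefect, rowDefect, rowRow_succ_left]; ring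

theorem rowDefect_succ_right (a b : ℕ) : rowDefect a (b + 1) = rowDefect a b -
    qInfFactorial * qInv ^ ((a + 1) * (b + 1)) / (qFact a * qFact (b + 1)) := by
  rw [rowDefect, rowDefect, rowRow_succ_right]; ring

theorem qInfFactorial_mul_div_mem_ordGE {N : ℤ} (k a b : ℕ) (h : N ≤ 2 * k) :
    qInfFactorial * qInv ^ k / (qFact a * qFact b) ∈ ordGE N := by
  rw [div_eq_mul_inv, mul_inv]
  exact mul_mem_ordGE_right (mul_mem_ordGE_left qInfFactorial_mem_ordGE (qInv_pow_mem_ordGE h))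
    (mul_mem_ordGE_left (inv_qFact_mem_ordGE a) (inv_qFact_mem_ordGE b))

theorem rowDefect_zero_mem_ordGE (b : ℕ) : rowDefect 0 b ∈ ordGE (2 * (b + 1)) := by
  have h := qFact_ne_zero b
  have : rowDefect 0 b = (qFact b - qInfFactorial) * (qFact b)⁻¹ := by
    rw [rowDefect, rowRow_zero_left]; field_simp
  rw [this]
  exact mul_mem_ordGE_right (qFact_sub_qInfFactorial_mem_ordGE b) (inv_qFact_mem_ordGE b)

theorem rowDefect_mem_ordGE (a b : ℕ) : rowDefect a b ∈ ordGE (2 * (a + 1) * (b + 1)) := by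
  -- A crude bound, used only to see that `rowDefect a b` tends to 0 as `b` grows. The sharp one
  -- then comes from telescoping in `b`, with increments of order at least `2 * (a + 1) * (c + 1)`.
  have weak : ∀ a b : ℕ, rowDefect a b ∈ ordGE b := fun a b => by
    induction a with
    | zero => exact ordGE_anti (by omega) (rowDefect_zero_mem_ordGE b)
    | succ a ih =>
      rw [rowDefect_succ_left]
      exact sub_mem ih (qInfFactorial_mul_div_mem_ordGE _ _ _ (by push_cast; nlinarith))
  refine mem_ordGE_of_telescope (S := rowDefect a) (weak a) (rowDefect_succ_right a) b fun c hc =>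
    qInfFactorial_mul_div_mem_ordGE _ _ _ ?_
  have : (b : ℤ) ≤ c := by exact_mod_cast hc
  push_cast; nlinarith

theorem rowDefect_mem_ordGE_zero (a b : ℕ) : rowDefect a b ∈ ordGE 0 :=
  ordGE_anti (by positivity) (rowDefect_mem_ordGE a b)

/-- Euler's identity `∑_j x^{(a + 1) j} / (x; x)_j = 1 / (x^{a + 1}; x)_∞`. -/
theorem hasSum_euler (a : ℕ) :
    HasSum (fun j => qInv ^ ((a + 1) * j) / qFact j) (qFact a / qInfFactorial) := by
  have hsum : Summable fun j => qInv ^ ((a + 1) * j) / qFact j :=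
    summable_of_mem_ordGE (fun j : ℕ => (j : ℤ)) (fun j => by
      rw [div_eq_mul_inv]
      exact mul_mem_ordGE_right (qInv_pow_mem_ordGE (by push_cast; nlinarith))
        (inv_qFact_mem_ordGE j)) (finite_nat_lt_of_le fun _ => le_rfl)
  have hlim : Tendsto (fun n => ∑ j ∈ Finset.range (n + 1), qInv ^ ((a + 1) * j) / qFact j) atTop
      (𝓝 (qFact a / qInfFactorial)) := by
    refine tendsto_of_sub_mem_ordGE fun N => eventually_atTop.mpr ⟨N.toNat, fun n hn => ?_⟩
    have h1 := qFact_ne_zero a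
    have h2 := qInfFactorial_ne_zero
    have : ∑ j ∈ Finset.range (n + 1), qInv ^ ((a + 1) * j) / qFact j - qFact a / qInfFactorial =
        qFact a * qInfFactorial⁻¹ * -rowDefect a n := by
      rw [rowDefect, rowRow, rowSum]; field_simp; ring
    rw [this]
    refine mul_mem_ordGE_left (mul_mem_ordGE_left (qFact_mem_ordGE _) inv_qInfFactorial_mem_ordGE)
      (neg_mem (ordGE_anti ?_ (rowDefect_mem_ordGE a n)))
    have : N ≤ n := by omega
    nlinarith
  rw [← tendsto_nhds_unique (hsum.hasSum.tendsto_sum_nat)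
    ((tendsto_add_atTop_iff_nat 1).mp hlim)]
  exact hsum.hasSum

theorem summable_rowDefect : Summable fun p : ℕ × ℕ => rowDefect p.1 p.2 :=
  summable_of_mem_ordGE (fun p => 2 * ((p.1 : ℤ) + 1) * (p.2 + 1))
    (fun p => rowDefect_mem_ordGE p.1 p.2) (finite_nat_prod_lt_of_le fun p => by nlinarith)

/-- From `a` to `a + 1` both sides drop by x^(a+1) / (1 - x^(a+1)), the left by Euler's identity and
the right by a geometric series, and both tend to 0. -/
theorem tsum_rowDefect_right (a : ℕ) : ∑' b, rowDefect a b =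
    ∑' m : ℕ, qInv ^ ((a + 1) * (m + 1)) / (1 - qInv ^ (m + 1)) := by
  have hX := qInfFactorial_ne_zero
  have hsumU : ∀ a : ℕ, Summable fun m : ℕ => qInv ^ ((a + 1) * (m + 1)) / (1 - qInv ^ (m + 1)) :=
    fun a => summable_of_mem_ordGE (fun m : ℕ => (m : ℤ)) (fun m => by
      rw [div_eq_mul_inv]
      exact mul_mem_ordGE_right (qInv_pow_mem_ordGE (by push_cast; nlinarith))
        (inv_one_sub_mem_ordGE m)) (finite_nat_lt_of_le fun _ => le_rfl)
  have hsumS : ∀ a, Summable (rowDefect a) := summable_rowDefect.prod_factor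
  refine congrFun (eq_of_telescope (S := fun a => ∑' b, rowDefect a b)
    (U := fun a => ∑' m : ℕ, qInv ^ ((a + 1) * (m + 1)) / (1 - qInv ^ (m + 1)))
    (r := fun a => qInv ^ (a + 1) * (1 - qInv ^ (a + 1))⁻¹) ?_ ?_ ?_ ?_) a
  · exact fun a => tsum_mem_ordGE fun b => ordGE_anti (by nlinarith) (rowDefect_mem_ordGE a b)
  · intro a
    refine tsum_mem_ordGE fun m => ?_
    rw [div_eq_mul_inv]
    exact mul_mem_ordGE_right (qInv_pow_mem_ordGE (by push_cast; nlinarith))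
      (inv_one_sub_mem_ordGE m)
  · intro a
    have h1 := qFact_ne_zero a
    have h2 := one_sub_qInv_pow_ne_zero a
    have h := ((hsumS a).hasSum).sub ((hasSum_euler a).mul_left
      (qInfFactorial * qInv ^ (a + 1) / qFact (a + 1)))
    have e : qInv ^ (a + 1) * (1 - qInv ^ (a + 1))⁻¹ =
        qInfFactorial * qInv ^ (a + 1) / qFact (a + 1) * (qFact a / qInfFactorial) := by
      rw [qFact_succ]; field_simp
    simp only [e]
    rw [← h.tsum_eq]
    refine tsum_congr fun b => ?_
    rw [rowDefect_succ_left, mul_add (a + 1), mul_one, pow_add]; ring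
  · intro a
    have h := ((hsumU a).hasSum).sub ((hasSum_qInv_pow a).mul_left (qInv ^ (a + 1)))
    rw [← h.tsum_eq]
    refine tsum_congr fun m => ?_
    have h2 := one_sub_qInv_pow_ne_zero m
    have e1 : qInv ^ (a + 1) * (qInv ^ (a + 1)) ^ m = qInv ^ ((a + 1) * (m + 1)) := by
      rw [← pow_mul, ← pow_add]; congr 1; ring
    have e2 : qInv ^ ((a + 1 + 1) * (m + 1)) = qInv ^ ((a + 1) * (m + 1)) * qInv ^ (m + 1) := by
      rw [← pow_add]; congr 1; ring
    rw [e1, e2]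
    field_simp
    ring

theorem tsum_rowDefect : ∑' p : ℕ × ℕ, rowDefect p.1 p.2 = lambertSum := by
  have hsum : Summable (Function.uncurry fun a m : ℕ =>
      qInv ^ ((a + 1) * (m + 1)) / (1 - qInv ^ (m + 1))) :=
    summable_of_mem_ordGE (fun p : ℕ × ℕ => 2 * (((p.1 + 1) * (p.2 + 1) : ℕ) : ℤ)) (fun p => by
      rw [Function.uncurry, div_eq_mul_inv]
      exact mul_mem_ordGE_right (qInv_pow_mem_ordGE le_rfl) (inv_one_sub_mem_ordGE p.2))
      (finite_nat_prod_lt_of_le fun p => by push_cast; nlinarith)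
  rw [summable_rowDefect.tsum_prod]
  simp only [tsum_rowDefect_right]
  rw [← hsum.tsum_comm, lambertSum]
  refine tsum_congr fun m => ?_
  have h2 := one_sub_qInv_pow_ne_zero m
  rw [qPow_eq_qInv_pow (k := m + 1) (by push_cast; ring)]
  have h := (hasSum_qInv_pow m).mul_left (qInv ^ (m + 1) / (1 - qInv ^ (m + 1)))
  rw [show qInv ^ (m + 1) / (1 - qInv ^ (m + 1)) ^ 2 =
    qInv ^ (m + 1) / (1 - qInv ^ (m + 1)) * (1 - qInv ^ (m + 1))⁻¹ by field_simp, ← h.tsum_eq]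
  refine tsum_congr fun a => ?_
  rw [add_mul, one_mul, pow_add, mul_comm a, pow_mul]; ring

/-- The relative error of replacing `rowDefect 0 b` by `x^{b + 1} / (1 - x)`. -/
noncomputable def edgeDefect (b : ℕ) : QSeries :=
  1 - (1 - qInv) / qInv ^ (b + 1) * rowDefect 0 b

theorem rowDefect_zero_eq (b : ℕ) :
    rowDefect 0 b = qInv ^ (b + 1) * (1 - qInv)⁻¹ * (1 - edgeDefect b) := by
  have h1 := one_sub_qInv_ne_zero
  have h2 := qInv_ne_zero
  rw [edgeDefect]; field_simp; ring

/-- Comes from δ(0,b) - δ(0,b+1) = x^(b+1) (1 - δ(0,b+1)). Each use gains a factor x, which drives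
the bound in `edgeDefect_mem_ordGE`. -/
theorem edgeDefect_eq (b : ℕ) :
    edgeDefect b = qInv * edgeDefect (b + 1) + (1 - qInv) * rowDefect 0 (b + 1) := by
  have h1 := qInv_ne_zero
  have h2 : rowDefect 0 (b + 1) = rowDefect 0 b - qInv ^ (b + 1) * (1 - rowDefect 0 (b + 1)) := by
    have h3 : 1 - rowDefect 0 (b + 1) = qInfFactorial / qFact (b + 1) := by
      rw [rowDefect, rowRow_zero_left]; ring
    rw [h3, rowDefect_succ_right, qFact_zero]
    ring
  rw [edgeDefect, edgeDefect, pow_succ qInv (b + 1)]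
  field_simp
  linear_combination (1 - qInv) * h2

theorem edgeDefect_mem_ordGE (b : ℕ) : edgeDefect b ∈ ordGE (2 * (b + 2)) := by
  have h0 : ∀ b, edgeDefect b ∈ ordGE 0 := fun b => by
    refine sub_mem one_mem_ordGE ?_
    rw [div_eq_mul_inv, mul_assoc]
    refine mul_mem_ordGE_left one_sub_qInv_mem_ordGE ?_
    have h := mul_mem_ordGE (M := -(2 * (b + 1))) (f := (qInv ^ (b + 1))⁻¹) ?_
      (rowDefect_zero_mem_ordGE b)
    · simpa using h
    · have : (qInv ^ (b + 1))⁻¹ = qHalfPow (2 * (b + 1)) := by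
        refine inv_eq_of_mul_eq_one_right ?_
        rw [qInv_pow, qHalfPow_mul, ← qHalfPow_zero]
        congr 1; push_cast; ring
      rw [this]
      exact qHalfPow_mem_ordGE le_rfl
  -- Each application of the recursion raises the order by 2, until the term `rowDefect 0 (b + 1)`
  -- of order `2 * (b + 2)` limits it.
  have key : ∀ n b : ℕ, edgeDefect b ∈ ordGE (min (2 * n) (2 * (b + 2))) := fun n => by
    induction n with
    | zero => intro b; exact ordGE_anti (by simp) (h0 b)
    | succ n ih =>
      intro b
      rw [edgeDefect_eq]
      refine add_mem ?_ (mul_mem_ordGE_left one_sub_qInv_mem_ordGE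
        (ordGE_anti ?_ (rowDefect_zero_mem_ordGE (b + 1))))
      · refine ordGE_anti ?_ (mul_mem_ordGE (qHalfPow_mem_ordGE (le_refl (- -2))) (ih (b + 1)))
        push_cast; omega
      · push_cast; omega
  exact ordGE_anti (by push_cast; omega) (key (b + 2) b)

theorem summable_edgeDefect : Summable edgeDefect :=
  summable_of_mem_ordGE (fun b : ℕ => 2 * ((b : ℤ) + 2)) edgeDefect_mem_ordGE
    (finite_nat_lt_of_le fun _ => by omega)

/-- The relative error of replacing `hookRow a b` by its limit. -/
noncomputable def hookDefect (a b : ℕ) : QSeries := 1 - (1 - qInv) * qInfFactorial * hookRow a b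

/-- The difference of `hookDefect a b` and `rowDefect (a + 1) b`. -/
noncomputable def hookCorrection (a b : ℕ) : QSeries :=
  (1 - qInv) * (qInfFactorial * qInv ^ ((b + 1) * (a + 1)) / (qFact b * qFact (a + 2)))

theorem hookDefect_eq (a b : ℕ) : hookDefect a b = rowDefect (a + 1) b + hookCorrection a b := by
  have h1 := one_sub_qInv_ne_zero
  have h2 := qFact_ne_zero b
  have h3 := qFact_ne_zero (a + 2)
  rw [hookDefect, rowDefect, hookCorrection, hookRow]
  field_simp
  ring

theorem hookCorrection_mem_ordGE (a b : ℕ) :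
    hookCorrection a b ∈ ordGE (2 * (a + 1) * (b + 1)) :=
  mul_mem_ordGE_left one_sub_qInv_mem_ordGE
    (qInfFactorial_mul_div_mem_ordGE _ _ _ (by push_cast; linarith))

theorem hookDefect_mem_ordGE (a b : ℕ) : hookDefect a b ∈ ordGE (2 * (a + 1) * (b + 1)) := by
  rw [hookDefect_eq]
  exact add_mem (ordGE_anti (by push_cast; nlinarith) (rowDefect_mem_ordGE (a + 1) b))
    (hookCorrection_mem_ordGE a b)

theorem summable_hookDefect : Summable fun p : ℕ × ℕ => hookDefect p.1 p.2 :=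
  summable_of_mem_ordGE (fun p => 2 * ((p.1 : ℤ) + 1) * (p.2 + 1))
    (fun p => hookDefect_mem_ordGE p.1 p.2) (finite_nat_prod_lt_of_le fun p => by nlinarith)

/-- Euler's series for `b` with its terms j = 0 and j = 1 removed. -/
theorem tsum_hookCorrection_left (b : ℕ) :
    ∑' a, hookCorrection a b = rowDefect 0 b - edgeDefect b := by
  have h1 := one_sub_qInv_ne_zero
  have h2 := qFact_ne_zero b
  have h3 := qInfFactorial_ne_zero
  have h4 := qInv_ne_zero
  have h := ((hasSum_nat_add_iff' 2).mpr (hasSum_euler b)).mul_left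
    ((1 - qInv) * qInfFactorial / (qInv ^ (b + 1) * qFact b))
  have e : (1 - qInv) * qInfFactorial / (qInv ^ (b + 1) * qFact b) * (qFact b / qInfFactorial -
      ∑ i ∈ Finset.range 2, qInv ^ ((b + 1) * i) / qFact i) = rowDefect 0 b - edgeDefect b := by
    rw [Finset.sum_range_succ, Finset.sum_range_one, edgeDefect, rowDefect, rowRow_zero_left,
      qFact_one, qFact_zero]
    simp only [mul_zero, mul_one, pow_zero]
    field_simp
    ring
  rw [← e, ← h.tsum_eq]
  refine tsum_congr fun a => ?_
  have e2 : qInv ^ ((b + 1) * (a + 2)) = qInv ^ (b + 1) * qInv ^ ((b + 1) * (a + 1)) := by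
    rw [← pow_add]; congr 1; ring
  have h5 := qFact_ne_zero (a + 2)
  rw [hookCorrection, e2]
  field_simp

/-- The shift to `rowDefect (a + 1) b` loses the edge ∑ δ(0,b); the corrections restore it up to ∑
ε. -/
theorem tsum_hookDefect : ∑' p : ℕ × ℕ, hookDefect p.1 p.2 = lambertSum - ∑' b, edgeDefect b := by
  have hrow : Summable fun p : ℕ × ℕ => rowDefect (p.1 + 1) p.2 :=
    summable_rowDefect.comp_injective (i := fun p : ℕ × ℕ => (p.1 + 1, p.2))
      fun p q h => by simpa [Prod.ext_iff] using h
  have hcor : Summable (Function.uncurry fun a b => hookCorrection a b) :=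
    summable_of_mem_ordGE (fun p => 2 * ((p.1 : ℤ) + 1) * (p.2 + 1))
      (fun p => hookCorrection_mem_ordGE p.1 p.2) (finite_nat_prod_lt_of_le fun p => by nlinarith)
  have h0 : Summable (rowDefect 0) := summable_rowDefect.prod_factor 0
  have e1 : ∑' p : ℕ × ℕ, rowDefect (p.1 + 1) p.2 = lambertSum - ∑' b, rowDefect 0 b := by
    rw [← tsum_rowDefect, summable_rowDefect.tsum_prod, hrow.tsum_prod,
      summable_rowDefect.prod.tsum_eq_zero_add]
    ring
  have e2 : ∑' p : ℕ × ℕ, hookCorrection p.1 p.2 = ∑' b, rowDefect 0 b - ∑' b, edgeDefect b := by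
    rw [← h0.tsum_sub summable_edgeDefect, ← tsum_congr tsum_hookCorrection_left, hcor.tsum_comm]
    exact hcor.tsum_prod
  simp only [hookDefect_eq]
  refine (hrow.tsum_add hcor).trans ?_
  change _ + ∑' p : ℕ × ℕ, hookCorrection p.1 p.2 = _
  linear_combination e1 + e2

/-! ### Summation over triples of fixed size. -/

theorem sum_sub_tsum_mem_ordGE {ι : Type*} {F : ι → QSeries} (hF : Summable F) (s : Finset ι)
    {N : ℤ} (h : ∀ i ∉ s, F i ∈ ordGE N) : ∑ i ∈ s, F i - ∑' i, F i ∈ ordGE N := by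
  rw [← hF.sum_add_tsum_subtype_compl s, sub_add_cancel_left]
  exact neg_mem (tsum_mem_ordGE fun i => h i.1 i.2)

/-- The pairs of natural numbers with sum less than `m`. -/
def pairs (m : ℕ) : Finset (ℕ × ℕ) := (Finset.range m).biUnion Finset.HasAntidiagonal.antidiagonal

theorem mem_pairs {m : ℕ} {p : ℕ × ℕ} : p ∈ pairs m ↔ p.1 + p.2 < m := by
  simp [pairs]

theorem card_pairs (m : ℕ) : (pairs m).card = (m + 1).choose 2 := by
  rw [pairs, Finset.card_biUnion]
  · simp only [Finset.Nat.card_antidiagonal]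
    induction m with
    | zero => rfl
    | succ m ih => rw [Finset.sum_range_succ, ih, Nat.choose_succ_succ' (m + 1) 1]; simp [add_comm]
  · intro i _ j _ hij
    rw [Function.onFun, Finset.disjoint_left]
    intro p h1 h2
    rw [Finset.HasAntidiagonal.mem_antidiagonal] at h1 h2
    exact hij (h1.symm.trans h2)

theorem sum_triples_eq_sum_pairs (n d : ℕ) (g : ℕ → ℕ → QSeries) :
    ∑ p ∈ triples n d, g p.1 p.2.1 = ∑ q ∈ pairs (d + 1 - n), g q.1 q.2 := by
  refine Finset.sum_nbij' (fun p => (p.1, p.2.1)) (fun q => (q.1, q.2, d - n - q.1 - q.2))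
    ?_ ?_ ?_ ?_ ?_
  · intro p hp; rw [mem_triples] at hp; rw [mem_pairs]; simp only; omega
  · intro q hq; rw [mem_pairs] at hq; rw [mem_triples]; simp only; omega
  · rintro ⟨a, b, c⟩ hp; rw [mem_triples] at hp; simp only [Prod.mk.injEq, true_and] at hp ⊢; omega
  · intro q _; rfl
  · intro p _; rfl

theorem sum_triples_rotate (n d : ℕ) (F : ℕ → ℕ → ℕ → QSeries) :
    ∑ p ∈ triples n d, F p.2.1 p.2.2 p.1 = ∑ p ∈ triples n d, F p.1 p.2.1 p.2.2 := by
  refine Finset.sum_nbij' (fun p => (p.2.1, p.2.2, p.1)) (fun p => (p.2.2, p.1, p.2.1))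
    ?_ ?_ ?_ ?_ ?_
  · intro p hp; rw [mem_triples] at hp ⊢; simp only; omega
  · intro p hp; rw [mem_triples] at hp ⊢; simp only; omega
  · intro p _; rfl
  · intro p _; rfl
  · intro p _; rfl

theorem sum_triples_swap (n d : ℕ) (F : ℕ → ℕ → ℕ → QSeries) :
    ∑ p ∈ triples n d, F p.1 p.2.2 p.2.1 = ∑ p ∈ triples n d, F p.1 p.2.1 p.2.2 := by
  refine Finset.sum_nbij' (fun p => (p.1, p.2.2, p.2.1)) (fun p => (p.1, p.2.2, p.2.1))
    ?_ ?_ ?_ ?_ ?_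
  · intro p hp; rw [mem_triples] at hp ⊢; simp only; omega
  · intro p hp; rw [mem_triples] at hp ⊢; simp only; omega
  · intro p _; rfl
  · intro p _; rfl
  · intro p _; rfl

theorem card_triples (n d : ℕ) : ((triples n d).card : QSeries) = ((d + 1 - n + 1).choose 2 : ℕ) := by
  rw [← card_pairs, Finset.cast_card, Finset.cast_card]
  exact sum_triples_eq_sum_pairs n d fun _ _ => 1

/-- The terms `rowDefect 0 b` with `b > d`, summed up to leading order. -/
theorem hasSum_edge (d : ℕ) :
    HasSum (fun p : ℕ × ℕ => if p.1 = 0 ∧ d < p.2 then qInv ^ (p.2 + 1) * (1 - qInv)⁻¹ else 0)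
      (qInv ^ (d + 2) * ((1 - qInv)⁻¹ * (1 - qInv)⁻¹)) := by
  have hinj : Function.Injective fun k : ℕ => (0, d + 1 + k) := fun i j h => by
    simpa using h
  rw [← hinj.hasSum_iff]
  · have h := (hasSum_qInv_pow 0).mul_left (qInv ^ (d + 2) * (1 - qInv)⁻¹)
    simp only [zero_add, pow_one] at h
    rw [← mul_assoc]
    convert! h using 2 with k
    simp only [Function.comp_apply]
    rw [if_pos ⟨trivial, by omega⟩, show d + 1 + k + 1 = d + 2 + k by ring, pow_add]
    ring
  · rintro ⟨a, b⟩ h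
    rw [if_neg]
    rintro ⟨rfl, hb⟩
    exact h ⟨b - (d + 1), by simp only [Prod.mk.injEq, true_and] at hb ⊢; omega⟩

/-- In the tail a + b > d only the leading terms on the two edges a = 0 and b = 0 are visible, and
each edge sums to x^(d+2) / (1 - x)². -/
theorem sum_pairs_rowDefect_mem_ordGE (d : ℕ) :
    ∑ q ∈ pairs (d + 1), rowDefect q.1 q.2 -
      (lambertSum - 2 * (qInv ^ (d + 2) * ((1 - qInv)⁻¹ * (1 - qInv)⁻¹))) ∈ ordGE (4 * d) := by
  obtain ⟨E, hE⟩ : ∃ E : ℕ × ℕ → QSeries, E = fun p =>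
    if p.1 = 0 ∧ d < p.2 then qInv ^ (p.2 + 1) * (1 - qInv)⁻¹ else 0 := ⟨_, rfl⟩
  have h1 := hasSum_edge d
  rw [← hE] at h1
  have h2 : HasSum (fun p : ℕ × ℕ => E p.swap) (qInv ^ (d + 2) * ((1 - qInv)⁻¹ * (1 - qInv)⁻¹)) :=
    (Equiv.prodComm ℕ ℕ).hasSum_iff.mpr h1
  have h3 := ((summable_rowDefect.hasSum).sub h1).sub h2
  rw [tsum_rowDefect] at h3
  have hedge : ∀ b : ℕ, d < b →
      rowDefect 0 b - qInv ^ (b + 1) * (1 - qInv)⁻¹ ∈ ordGE (4 * d) := fun b hb => by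
    rw [rowDefect_zero_eq, show ∀ y : QSeries, y * (1 - edgeDefect b) - y = -(y * edgeDefect b) from
      fun y => by ring]
    refine neg_mem (ordGE_anti ?_ (mul_mem_ordGE (mul_mem_ordGE_right (qInv_pow_mem_ordGE le_rfl)
      inv_one_sub_qInv_mem_ordGE) (edgeDefect_mem_ordGE b)))
    push_cast; omega
  have h4 := sum_sub_tsum_mem_ordGE h3.summable (pairs (d + 1)) (N := 4 * d) fun p hp => ?_
  · rw [h3.tsum_eq] at h4
    convert h4 using 1
    rw [two_mul, ← sub_sub]
    congr 1
    refine Finset.sum_congr rfl fun p hp => ?_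
    rw [mem_pairs] at hp
    simp only [hE, Prod.fst_swap, Prod.snd_swap]
    rw [if_neg (by omega), if_neg (by omega)]
    simp
  · obtain ⟨a, b⟩ := p
    rw [mem_pairs] at hp
    simp only [hE, Prod.fst_swap, Prod.snd_swap] at hp ⊢
    rcases Nat.eq_zero_or_pos a with rfl | ha
    · rw [if_pos ⟨rfl, by omega⟩, if_neg (by omega), sub_zero]
      exact hedge b (by omega)
    · rcases Nat.eq_zero_or_pos b with rfl | hb
      · rw [if_neg (by omega), if_pos ⟨rfl, by omega⟩, sub_zero, rowDefect_comm]
        exact hedge a (by omega)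
      · rw [if_neg (by omega), if_neg (by omega), sub_zero, sub_zero]
        refine ordGE_anti ?_ (rowDefect_mem_ordGE a b)
        have : (d : ℤ) + 1 ≤ a + b := by omega
        have ha' : (1 : ℤ) ≤ a := by omega
        have hb' : (1 : ℤ) ≤ b := by omega
        -- (a - 1)(b - 1) ≥ 0 amounts to (a + 1)(b + 1) ≥ 2 (a + b).
        nlinarith [mul_nonneg (sub_nonneg.mpr ha') (sub_nonneg.mpr hb')]

/-- The order 2(b + 1)(a + c + 2) of a term reaches 4d when the shared index b is positive. The
terms with b = 0 are products of two edge defects. -/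
theorem sum_triples_rowDefect_mul_mem_ordGE (d : ℕ) :
    ∑ p ∈ triples 0 d, rowDefect p.1 p.2.1 * rowDefect p.2.1 p.2.2 -
      qInv ^ (d + 2) * ((1 - qInv)⁻¹ * (1 - qInv)⁻¹) * ((d + 1 : ℕ) - 2 * ∑' b, edgeDefect b) ∈
        ordGE (4 * d) := by
  have e0 : ∑ p ∈ (triples 0 d).filter (fun p => p.2.1 = 0),
      rowDefect p.1 p.2.1 * rowDefect p.2.1 p.2.2 =
      ∑ q ∈ Finset.HasAntidiagonal.antidiagonal d, rowDefect 0 q.1 * rowDefect 0 q.2 := by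
    refine Finset.sum_nbij' (fun p => (p.1, p.2.2)) (fun q => (q.1, 0, q.2)) ?_ ?_ ?_ ?_ ?_
    · intro p hp
      rw [Finset.mem_filter, mem_triples] at hp
      rw [Finset.HasAntidiagonal.mem_antidiagonal]; simp only; omega
    · intro q hq
      rw [Finset.HasAntidiagonal.mem_antidiagonal] at hq
      exact Finset.mem_filter.mpr ⟨mem_triples.mpr (by simpa using hq), rfl⟩
    · rintro ⟨a, b, c⟩ hp
      obtain ⟨-, h⟩ := Finset.mem_filter.mp hp
      simp only at h ⊢; rw [h]
    · intro q _; rfl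
    · rintro ⟨a, b, c⟩ hp
      obtain ⟨-, h⟩ := Finset.mem_filter.mp hp
      simp only at h ⊢; rw [h, rowDefect_comm a 0]
  have e1 : ∑ q ∈ Finset.HasAntidiagonal.antidiagonal d, rowDefect 0 q.1 * rowDefect 0 q.2 =
      qInv ^ (d + 2) * ((1 - qInv)⁻¹ * (1 - qInv)⁻¹) * ((d + 1 : ℕ) -
        2 * ∑ b ∈ Finset.range (d + 1), edgeDefect b +
          ∑ q ∈ Finset.HasAntidiagonal.antidiagonal d, edgeDefect q.1 * edgeDefect q.2) := by
    have h1 : ∑ q ∈ Finset.HasAntidiagonal.antidiagonal d, edgeDefect q.1 =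
        ∑ b ∈ Finset.range (d + 1), edgeDefect b :=
      Finset.Nat.sum_antidiagonal_eq_sum_range_succ_mk (fun q => edgeDefect q.1) d
    have h2 : ∑ q ∈ Finset.HasAntidiagonal.antidiagonal d, edgeDefect q.2 =
        ∑ b ∈ Finset.range (d + 1), edgeDefect b := by
      rw [← h1]; exact Finset.Nat.sum_antidiagonal_swap (f := fun q => edgeDefect q.1)
    have h3 : ((d + 1 : ℕ) : QSeries) = ∑ q ∈ Finset.HasAntidiagonal.antidiagonal d, 1 := by simp
    rw [two_mul]
    nth_rw 1 [← h1]
    rw [← h2, h3, ← Finset.sum_add_distrib, ← Finset.sum_sub_distrib, ← Finset.sum_add_distrib,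
      Finset.mul_sum]
    refine Finset.sum_congr rfl fun q hq => ?_
    rw [Finset.HasAntidiagonal.mem_antidiagonal] at hq
    rw [rowDefect_zero_eq, rowDefect_zero_eq, ← hq]
    ring
  rw [← Finset.sum_filter_add_sum_filter_not (triples 0 d) fun p => p.2.1 = 0, e0, e1,
    show ∀ y A B C D Z : QSeries, y * (A - 2 * B + C) + Z - y * (A - 2 * D) =
      y * (C - (B - D) - (B - D)) + Z from fun y A B C D Z => by ring]
  -- Precision `2 * d` suffices, as the prefactor x^(d+2) has order 2d + 4.
  have htail := sum_sub_tsum_mem_ordGE summable_edgeDefect (Finset.range (d + 1)) (N := 2 * d)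
    fun b hb => ordGE_anti (by rw [Finset.mem_range] at hb; omega) (edgeDefect_mem_ordGE b)
  refine add_mem (ordGE_anti (by push_cast; omega) (mul_mem_ordGE (mul_mem_ordGE_right
    (qInv_pow_mem_ordGE (k := d + 2) le_rfl)
      (mul_mem_ordGE_left inv_one_sub_qInv_mem_ordGE inv_one_sub_qInv_mem_ordGE))
    (sub_mem (sub_mem (sum_mem fun q hq => ?_) htail) htail))) (sum_mem fun p hp => ?_)
  · rw [Finset.HasAntidiagonal.mem_antidiagonal] at hq
    exact ordGE_anti (by omega) (mul_mem_ordGE (edgeDefect_mem_ordGE q.1) (edgeDefect_mem_ordGE q.2))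
  · obtain ⟨a, b, c⟩ := p
    rw [Finset.mem_filter, mem_triples] at hp
    simp only at hp ⊢
    refine ordGE_anti ?_ (mul_mem_ordGE (rowDefect_mem_ordGE a b) (rowDefect_mem_ordGE b c))
    have h1 : (d : ℤ) = a + b + c := by omega
    have h2 : (1 : ℤ) ≤ b := by omega
    rw [h1]
    nlinarith [mul_nonneg (Int.natCast_nonneg a) (sub_nonneg.mpr h2),
      mul_nonneg (Int.natCast_nonneg c) (sub_nonneg.mpr h2)]

theorem sum_triples_rowRow_mem_ordGE (d : ℕ) :
    qInfFactorial ^ 3 * ∑ p ∈ triples 0 d, rowRow p.1 p.2.1 * rowRow p.2.1 p.2.2 * rowRow p.2.2 p.1 -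
      (((d + 2).choose 2 : ℕ) -
        3 * (lambertSum - 2 * (qInv ^ (d + 2) * ((1 - qInv)⁻¹ * (1 - qInv)⁻¹))) +
        3 * (qInv ^ (d + 2) * ((1 - qInv)⁻¹ * (1 - qInv)⁻¹) *
          ((d + 1 : ℕ) - 2 * ∑' b, edgeDefect b))) ∈ ordGE (4 * d) := by
  have hS1 := (sum_triples_eq_sum_pairs 0 d rowDefect).symm ▸ sum_pairs_rowDefect_mem_ordGE d
  have hS2 := sum_triples_rowDefect_mul_mem_ordGE d
  have hS3 : ∑ p ∈ triples 0 d, rowDefect p.1 p.2.1 * rowDefect p.2.1 p.2.2 * rowDefect p.2.2 p.1 ∈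
      ordGE (4 * d) := by
    refine sum_mem fun p hp => ?_
    rw [mem_triples] at hp
    refine ordGE_anti ?_ (mul_mem_ordGE (mul_mem_ordGE (rowDefect_mem_ordGE p.1 p.2.1)
      (rowDefect_mem_ordGE p.2.1 p.2.2)) (rowDefect_mem_ordGE p.2.2 p.1))
    rw [← hp]
    push_cast
    have h1 := mul_nonneg (Int.natCast_nonneg p.1) (Int.natCast_nonneg p.2.1)
    have h2 := mul_nonneg (Int.natCast_nonneg p.2.1) (Int.natCast_nonneg p.2.2)
    have h3 := mul_nonneg (Int.natCast_nonneg p.2.2) (Int.natCast_nonneg p.1)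
    linarith
  set A := ∑ p ∈ triples 0 d, rowDefect p.1 p.2.1 with hA
  set B := ∑ p ∈ triples 0 d, rowDefect p.1 p.2.1 * rowDefect p.2.1 p.2.2 with hB
  set C := ∑ p ∈ triples 0 d, rowDefect p.1 p.2.1 * rowDefect p.2.1 p.2.2 * rowDefect p.2.2 p.1
    with hC
  have hA2 := sum_triples_rotate 0 d fun a b _ => rowDefect a b
  have hA3 := sum_triples_rotate 0 d fun a b c => rowDefect b c
  have hB2 := sum_triples_rotate 0 d fun a b c => rowDefect a b * rowDefect b c
  have hB3 := sum_triples_rotate 0 d fun a b c => rowDefect b c * rowDefect c a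
  have e : qInfFactorial ^ 3 *
      ∑ p ∈ triples 0 d, rowRow p.1 p.2.1 * rowRow p.2.1 p.2.2 * rowRow p.2.2 p.1 =
      ((d + 2).choose 2 : ℕ) - 3 * A + 3 * B - C := by
    have hone : (((d + 2).choose 2 : ℕ) : QSeries) = ∑ p ∈ triples 0 d, 1 := by
      rw [Finset.sum_const, nsmul_eq_mul, mul_one, card_triples]
      rfl
    have h3A : 3 * A = ∑ p ∈ triples 0 d, (rowDefect p.1 p.2.1 + rowDefect p.2.1 p.2.2 +
        rowDefect p.2.2 p.1) := by
      rw [Finset.sum_add_distrib, Finset.sum_add_distrib, hA2, hA3, hA2]; ring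
    have h3B : 3 * B = ∑ p ∈ triples 0 d, (rowDefect p.1 p.2.1 * rowDefect p.2.1 p.2.2 +
        rowDefect p.2.1 p.2.2 * rowDefect p.2.2 p.1 +
        rowDefect p.2.2 p.1 * rowDefect p.1 p.2.1) := by
      rw [Finset.sum_add_distrib, Finset.sum_add_distrib, hB2, hB3, hB2]; ring
    rw [h3A, h3B, hone, hC, ← Finset.sum_sub_distrib, ← Finset.sum_add_distrib,
      ← Finset.sum_sub_distrib, Finset.mul_sum]
    refine Finset.sum_congr rfl fun p _ => ?_
    simp only [rowDefect]
    ring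
  rw [e, show ∀ n A B C a b : QSeries, n - 3 * A + 3 * B - C - (n - 3 * a + 3 * b) =
    -3 * (A - a) + 3 * (B - b) - C from fun n A B C a b => by ring]
  have h3 : (3 : QSeries) ∈ ordGE 0 := by exact_mod_cast natCast_mem_ordGE 3
  exact sub_mem (add_mem (mul_mem_ordGE_left (neg_mem h3) hS1) (mul_mem_ordGE_left h3 hS2)) hS3

/-- Precision `2 * d` is enough because the hook terms carry a factor x^(d+2). At this precision the
tails of the defect sums and all products of defects vanish. -/
theorem sum_triples_hookRow_mem_ordGE (d : ℕ) (hd : 1 ≤ d) :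
    (1 - qInv) ^ 2 * qInfFactorial ^ 3 *
        ∑ p ∈ triples 2 d, hookRow p.1 p.2.1 * rowRow p.2.1 p.2.2 * hookRow p.1 p.2.2 -
      ((d.choose 2 : ℕ) - lambertSum - 2 * (lambertSum - ∑' b, edgeDefect b)) ∈ ordGE (2 * d) := by
  have hm : d - 1 = d + 1 - 2 := by omega
  have hmono : ∀ p ∉ pairs (d - 1), (2 * d : ℤ) ≤ 2 * ((p.1 : ℤ) + 1) * (p.2 + 1) := fun p hp => by
    rw [mem_pairs] at hp
    have h1 : (d : ℤ) ≤ p.1 + p.2 + 1 := by omega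
    nlinarith [mul_nonneg (Int.natCast_nonneg p.1) (Int.natCast_nonneg p.2)]
  have hS1 := sum_sub_tsum_mem_ordGE summable_rowDefect (pairs (d - 1)) fun p hp =>
    ordGE_anti (hmono p hp) (rowDefect_mem_ordGE p.1 p.2)
  have hS2 := sum_sub_tsum_mem_ordGE summable_hookDefect (pairs (d - 1)) fun p hp =>
    ordGE_anti (hmono p hp) (hookDefect_mem_ordGE p.1 p.2)
  rw [tsum_rowDefect, hm, ← sum_triples_eq_sum_pairs 2 d, ← sum_triples_rotate 2 d fun a b _ =>
    rowDefect a b] at hS1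
  rw [tsum_hookDefect, hm, ← sum_triples_eq_sum_pairs 2 d] at hS2
  have hswap := sum_triples_swap 2 d fun a b _ => hookDefect a b
  set A := ∑ p ∈ triples 2 d, rowDefect p.2.1 p.2.2 with hA
  set B := ∑ p ∈ triples 2 d, hookDefect p.1 p.2.1 with hB
  -- The terms of degree two and three in the expansion of (1 - η)(1 - η')(1 - δ).
  set C := ∑ p ∈ triples 2 d, (hookDefect p.1 p.2.1 * rowDefect p.2.1 p.2.2 +
    hookDefect p.1 p.2.2 * rowDefect p.2.1 p.2.2 +
    hookDefect p.1 p.2.1 * hookDefect p.1 p.2.2 * (1 - rowDefect p.2.1 p.2.2)) with hC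
  have hS3 : C ∈ ordGE (2 * d) := by
    refine sum_mem fun ⟨a, b, c⟩ hp => ?_
    rw [mem_triples] at hp
    simp only at hp ⊢
    have h1 : (d : ℤ) = a + b + c + 2 := by omega
    have hab := mul_nonneg (Int.natCast_nonneg a) (Int.natCast_nonneg b)
    have hbc := mul_nonneg (Int.natCast_nonneg b) (Int.natCast_nonneg c)
    have hac := mul_nonneg (Int.natCast_nonneg a) (Int.natCast_nonneg c)
    refine add_mem (add_mem ?_ ?_) (mul_mem_ordGE_right ?_
      (sub_mem one_mem_ordGE (rowDefect_mem_ordGE_zero b c)))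
    · exact ordGE_anti (by rw [h1]; nlinarith)
        (mul_mem_ordGE (hookDefect_mem_ordGE a b) (rowDefect_mem_ordGE b c))
    · exact ordGE_anti (by rw [h1]; nlinarith)
        (mul_mem_ordGE (hookDefect_mem_ordGE a c) (rowDefect_mem_ordGE b c))
    · exact ordGE_anti (by rw [h1]; nlinarith)
        (mul_mem_ordGE (hookDefect_mem_ordGE a b) (hookDefect_mem_ordGE a c))
  have e : (1 - qInv) ^ 2 * qInfFactorial ^ 3 *
      ∑ p ∈ triples 2 d, hookRow p.1 p.2.1 * rowRow p.2.1 p.2.2 * hookRow p.1 p.2.2 =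
      (d.choose 2 : ℕ) - A - 2 * B + C := by
    have hone : ((d.choose 2 : ℕ) : QSeries) = ∑ p ∈ triples 2 d, 1 := by
      -- Truncated subtraction: for `d = 0` the left side would be 1, so `hd` enters here.
      rw [Finset.sum_const, nsmul_eq_mul, mul_one, card_triples, show d + 1 - 2 + 1 = d by omega]
    have h2B : 2 * B = ∑ p ∈ triples 2 d, (hookDefect p.1 p.2.1 + hookDefect p.1 p.2.2) := by
      rw [Finset.sum_add_distrib, hswap]; ring
    rw [h2B, hone, hA, hC, ← Finset.sum_sub_distrib, ← Finset.sum_sub_distrib,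
      ← Finset.sum_add_distrib, Finset.mul_sum]
    refine Finset.sum_congr rfl fun p _ => ?_
    simp only [rowDefect, hookDefect]
    ring
  rw [e, show ∀ n A B C a b : QSeries, n - A - 2 * B + C - (n - a - 2 * b) =
    -(A - a) + -2 * (B - b) + C from fun n A B C a b => by ring]
  have h2 : (2 : QSeries) ∈ ordGE 0 := by exact_mod_cast natCast_mem_ordGE 2
  exact add_mem (add_mem (neg_mem hS1) (mul_mem_ordGE_left (neg_mem h2) hS2)) hS3

/-! ### Assembly. -/

theorem eqAbove_of_sub_mem_ordGE {N : ℤ} {f g : QSeries} (h : f - g ∈ ordGE (-(2 * N))) :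
    EqAbove N f g := fun n hn => by
  have := h (-n) (by omega)
  rwa [HahnSeries.coeff_sub, sub_eq_zero] at this

end LocalP2

open LocalP2 in
theorem mainTheorem7 (d : ℕ) (hd : 1 ≤ d) :
    LocalP2.EqAbove (-(2 * (d : ℤ)))
      ((-1) ^ d * LocalP2.qHalfPow (-((d : ℤ) ^ 2 - 3 * (d : ℤ))) * LocalP2.coeffI d)
      (1 / LocalP2.qInfFactorial ^ 3 *
        ((((d + 2).choose 2 : ℕ) - 3 * LocalP2.lambertSum) +
          3 * LocalP2.qPow (-(d : ℤ) - 2) / (1 - LocalP2.qPow (-1)) ^ 2 *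
            (((d + 1).choose 2 : ℕ) - 3 * LocalP2.lambertSum + 3))) := by
  refine eqAbove_of_sub_mem_ordGE ?_
  rw [normalized_coeffI, qPow_eq_qInv_pow (n := -(d : ℤ) - 2) (k := d + 2) (by push_cast; ring),
    qPow_eq_qInv_pow (n := -1) (k := 1) (by norm_num), pow_one,
    show -(2 * -(2 * (d : ℤ))) = 4 * d by ring]
  have h0 := sum_hopfTriple_sub_mem_ordGE d
  have h1 := sum_triples_rowRow_mem_ordGE d
  have h2 := sum_triples_hookRow_mem_ordGE d hd
  rw [Finset.sum_congr rfl fun p hp => hopfTriple_row hp,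
    Finset.sum_congr rfl fun p hp => hopfTriple_hook hp, ← Finset.mul_sum _ _ (qInv ^ (d + 2))] at h0
  have hX := qInfFactorial_ne_zero
  have hx := one_sub_qInv_ne_zero
  have hinv := mul_mem_ordGE_left inv_one_sub_qInv_mem_ordGE inv_one_sub_qInv_mem_ordGE
  have h3 : (3 : QSeries) ∈ ordGE 0 := by exact_mod_cast natCast_mem_ordGE 3
  have h2' := ordGE_anti (by push_cast; omega : (4 * d : ℤ) ≤ 2 * (d + 2 : ℕ) + 2 * d)
    (mul_mem_ordGE (mul_mem_ordGE_right (qInv_pow_mem_ordGE (k := d + 2) le_rfl) hinv) h2)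
  have h := add_mem h0 (mul_mem_ordGE_left (pow_mem_ordGE inv_qInfFactorial_mem_ordGE 3)
    (add_mem h1 (mul_mem_ordGE_left h3 h2')))
  convert h using 1
  -- Pascal's rule C(d+1, 2) = d + C(d, 2) merges the edge terms of the rows with the count of hook
  -- triples; the sums of `edgeDefect` cancel.
  rw [Nat.choose_succ_succ' d 1, Nat.choose_one_right]
  push_cast
  generalize ∑ m ∈ (finite_triples d).toFinset,
    qHalfPow (-((d : ℤ) ^ 2 - 3 * (d : ℤ))) * hopfTriple m = T
  field_simp
  ring
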